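/- A rooted map is a proper embedding of a finite connected graph (loops and multiple edges allowed) with at least one edge into the two-dimensional sphere, considered up to orientation-preserving homeomorphism (continuous deformation), together with a distinguished oriented edge, called the root. The face on the right of the root is the root-face; the other faces are internal. A vertex is external if it is incident to the root-face and internal otherwise. The degree of a face is the number of edge-sides on its boundary, and the degree of a vertex is the number of half-edges at it. A map is a near-triangulation if all its internal faces have degree $3$, and it is non-separable if it has no loop and the deletion of any one vertex does not disconnect it. (In particular, the map consisting of a single edge joining two vertices is a non-separable near-triangulation, with root-face of degree $2$.) Let $\mathbf{T}$ be the set of non-separable rooted near-triangulations in which every internal vertex has degree at least $3$. For $n,d\ge 0$ let $a_{n,d}$ be the number of maps in $\mathbf{T}$ with $n$ edges and root-face of degree $d+2$, and let $$\mathbb{T}(x)=\mathbb{T}(x,z)=\sum_{n,d\ge 0} a_{n,d}\,x^d z^n ,$$ a formal power series in $z$ whose coefficients are polynomials in $x$. Write $\mathbb{T}(0)=\mathbb{T}(0,z)$. Proposition. The generating function $\mathbb{T}(x)$ satisfies $$\mathbb{T}(x)=z+xz\,\mathbb{T}(x)^2+z\left(\frac{\mathbb{T}(x)-\mathbb{T}(0)}{x}\right)-z^3\,\mathbb{T}(x).$$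 -/

import Mathlib

/-- A rooted planar map, encoded by its rotation system on the finite set `D` of darts
(half-edges; equivalently, oriented edges).

* `σ` sends a dart to the next dart in counterclockwise order around its origin, so that the
  vertices are the cycles of `σ`;
* `α` reverses a dart, so that the edges are the (two-element) cycles of `α`;
* `σ * α` (first `α`, then `σ`) sends a dart to the next dart along the boundary of the face on
  its right, so that the faces are the cycles of `σ * α`;
* the map is connected, and it is drawn on the sphere, which is expressed by Euler's relation
  `V + F = E + 2`;
* the root is an oriented edge, that is, a dart. -/
structure RootedMap (D : Type*) where
  σ : Equiv.Perm D
  α : Equiv.Perm D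
  root : D
  α_invol : ∀ d, α (α d) = d
  α_ne : ∀ d, α d ≠ d
  connected : ∀ a b, ∃ g ∈ Subgroup.closure {σ, α}, g a = b
  euler : Nat.card (Quotient (Equiv.Perm.SameCycle.setoid σ))
      + Nat.card (Quotient (Equiv.Perm.SameCycle.setoid (σ * α)))
      = Nat.card (Quotient (Equiv.Perm.SameCycle.setoid α)) + 2

namespace RootedMap

variable {D D' : Type*}

/-- The vertices of a map. -/
def Vertex (M : RootedMap D) : Type _ := Quotient (Equiv.Perm.SameCycle.setoid M.σ)

/-- The faces of a map. -/
def Face (M : RootedMap D) : Type _ := Quotient (Equiv.Perm.SameCycle.setoid (M.σ * M.α))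

/-- The origin of a dart. The end of `d` is `M.origin (M.α d)`. -/
def origin (M : RootedMap D) (d : D) : M.Vertex := Quotient.mk _ d

/-- The face on the right of a dart. -/
def rightFace (M : RootedMap D) (d : D) : M.Face := Quotient.mk _ d

/-- The degree of a vertex: the number of darts leaving it (a loop would count twice). -/
noncomputable def vertexDegree (M : RootedMap D) (v : M.Vertex) : ℕ :=
  Nat.card {d : D // M.origin d = v}

/-- The degree of a face: the number of darts with this face on their right
(an edge with the face on both sides counts twice). -/
noncomputable def faceDegree (M : RootedMap D) (f : M.Face) : ℕ :=
  Nat.card {d : D // M.rightFace d = f}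

/-- The root-face is the face on the right of the root. All other faces are internal. -/
def rootFace (M : RootedMap D) : M.Face := M.rightFace M.root

/-- A vertex is external if it is incident to the root-face, and internal otherwise. -/
def IsExternal (M : RootedMap D) (v : M.Vertex) : Prop :=
  ∃ d : D, M.rightFace d = M.rootFace ∧ M.origin d = v

/-- All internal faces have degree 3. -/
def IsNearTriangulation (M : RootedMap D) : Prop :=
  ∀ f : M.Face, f ≠ M.rootFace → M.faceDegree f = 3

/-- No edge is a loop. -/
def Loopless (M : RootedMap D) : Prop :=
  ∀ d : D, M.origin (M.α d) ≠ M.origin d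

/-- The adjacency relation between distinct vertices of the underlying graph. -/
def graph (M : RootedMap D) : SimpleGraph M.Vertex where
  Adj u v := u ≠ v ∧ ∃ d : D, M.origin d = u ∧ M.origin (M.α d) = v
  symm := ⟨by
    rintro u v ⟨h, d, hu, hv⟩
    exact ⟨h.symm, M.α d, hv, by rw [M.α_invol]; exact hu⟩⟩
  loopless := ⟨fun _ h => h.1 rfl⟩

/-- A map is non-separable if it has no loop and the deletion of a vertex never disconnects it. -/
def IsNonSeparable (M : RootedMap D) : Prop :=
  M.Loopless ∧ ∀ v : M.Vertex, (M.graph.induce {v}ᶜ).Preconnected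

/-- Membership in the class `T`: non-separable near-triangulations all of whose internal vertices
have degree at least 3. -/
def IsT (M : RootedMap D) : Prop :=
  M.IsNonSeparable ∧ M.IsNearTriangulation ∧
    ∀ v : M.Vertex, ¬ M.IsExternal v → 3 ≤ M.vertexDegree v

/-- Isomorphism of rooted maps (homeomorphic equivalence preserving orientation and root). -/
def Iso (M : RootedMap D) (N : RootedMap D') : Prop :=
  ∃ e : D ≃ D', (∀ d, e (M.σ d) = N.σ (e d)) ∧ (∀ d, e (M.α d) = N.α (e d)) ∧ e M.root = N.root

/-- Isomorphism as an equivalence relation on the maps with a given set of darts. -/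
def isoSetoid (D : Type*) : Setoid (RootedMap D) where
  r M N := M.Iso N
  iseqv :=
    { refl := fun _ => ⟨Equiv.refl _, fun _ => rfl, fun _ => rfl, rfl⟩
      symm := by
        rintro M N ⟨e, h1, h2, h3⟩
        refine ⟨e.symm, fun d => ?_, fun d => ?_, ?_⟩
        · rw [Equiv.symm_apply_eq, h1, Equiv.apply_symm_apply]
        · rw [Equiv.symm_apply_eq, h2, Equiv.apply_symm_apply]
        · rw [Equiv.symm_apply_eq, h3]
      trans := by
        rintro M N P ⟨e, h1, h2, h3⟩ ⟨f, g1, g2, g3⟩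
        exact ⟨e.trans f, fun d => by simp [h1, g1], fun d => by simp [h2, g2],
          by simp [h3, g3]⟩ }

end RootedMap

/-- The number of maps in the class `T`, up to isomorphism, with `n` edges (that is, `2 * n` darts)
and root-face of degree `d + 2`. -/
noncomputable def countT (n d : ℕ) : ℕ :=
  Nat.card (Quotient ((RootedMap.isoSetoid (Fin (2 * n))).comap
    (Subtype.val : {M : RootedMap (Fin (2 * n)) //
      M.IsT ∧ M.faceDegree M.rootFace = d + 2} → RootedMap (Fin (2 * n)))))

/-- The generating function `∑ countT n d * x ^ d * z ^ n`, a power series in `z` whose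
coefficients are polynomials in `x` (the bound on `d` loses nothing, see `coeff_coeff_seriesT`). -/
noncomputable def seriesT : PowerSeries (Polynomial ℤ) :=
  PowerSeries.mk fun n => ∑ d ∈ Finset.range (2 * n), Polynomial.monomial d (countT n d : ℤ)

theorem countT_eq_zero {n d : ℕ} (h : 2 * n ≤ d) : countT n d = 0 := by
  have : IsEmpty {M : RootedMap (Fin (2 * n)) //
      M.IsT ∧ M.faceDegree M.rootFace = d + 2} := by
    refine ⟨fun ⟨M, _, hM⟩ => ?_⟩
    have h1 : M.faceDegree M.rootFace ≤ Nat.card (Fin (2 * n)) :=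
      Nat.card_le_card_of_injective _ Subtype.val_injective
    rw [Nat.card_eq_fintype_card, Fintype.card_fin] at h1
    omega
  unfold countT
  rw [Nat.card_eq_zero]
  exact Or.inl ⟨fun q => this.elim (Quotient.exists_rep q).choose⟩

theorem coeff_coeff_seriesT (n d : ℕ) :
    (PowerSeries.coeff n seriesT).coeff d = (countT n d : ℤ) := by
  simp only [seriesT, PowerSeries.coeff_mk, Polynomial.finsetSum_coeff,
    Polynomial.coeff_monomial, Finset.sum_ite_eq', Finset.mem_range]
  split_ifs with h
  · rfl
  · rw [countT_eq_zero (not_lt.mp h), Nat.cast_zero]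

/-- `F(0, z)`, for a power series `F(x, z)` in `z` with polynomial coefficients in `x`. -/
noncomputable def atZero (F : PowerSeries (Polynomial ℤ)) : PowerSeries (Polynomial ℤ) :=
  PowerSeries.mk fun n => Polynomial.C ((PowerSeries.coeff n F).eval 0)

/-!
Delete the root of a map of the class other than the single edge, and let `v` be the third vertex
of the triangle to the left of the root. If `v` was internal, then what is left, with root ending
at `v`, is again a map of the class; its root-face and the end of its root have degree at least
three, and such a map, called closable, determines the original one, by `close`. If `v` was
external, it is now a cut vertex, and what is left is a `wedge` of two maps of the class. So
`T = z + x z T ^ 2 + z K`, where `x K` counts the closable maps. A map of the class with root-face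
of degree at least three that is not closable has a root whose end has degree two. Removing that
end removes two edges of a triangle and leaves an arbitrary map of the class, with a root-face
whose degree is smaller by one, so that `T - T(0) = x (K + z ^ 2 T)`.

Planarity enters through the genus: adding or removing a transposition in the vertex permutation
and the face permutation splits and merges cycles, and a splitting of a connected map that would
give negative genus has to disconnect it.
-/

namespace PermCycles

open Equiv (Perm swap swap_apply_left swap_apply_right swap_apply_of_ne_of_ne swap_mul_self_mul)
open Equiv.Perm

section Invariant

variable {D D' : Type*}

/-- The group of the permutations that move no point out of its class. It serves to extend a
property of the generators of a group of permutations to the whole group. -/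
def classPreserving (r : Setoid D) : Subgroup (Perm D) where
  carrier := {g | ∀ x, r x (g x)}
  one_mem' := r.refl
  mul_mem' := fun hf hg x => r.trans (hg x) (hf _)
  inv_mem' := fun {f} hf x => r.symm (by simpa using hf (f⁻¹ x))

theorem setoid_le_iff {f : Perm D} {r : Setoid D} :
    SameCycle.setoid f ≤ r ↔ ∀ x, r x (f x) := by
  refine ⟨fun h x => h (sameCycle_apply_right.2 (SameCycle.refl f x)), ?_⟩
  rintro h x _ ⟨n, rfl⟩
  exact (classPreserving r).zpow_mem (show f ∈ classPreserving r from h) n x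

/-- A set of points, given as a predicate, that is a union of cycles of `f`. -/
def IsInvariant (f : Perm D) (S : D → Prop) : Prop := ∀ x, S (f x) ↔ S x

theorem IsInvariant.iff_of_sameCycle {f : Perm D} {S : D → Prop} (hS : IsInvariant f S) {x y : D}
    (hxy : f.SameCycle x y) : S x ↔ S y :=
  iff_of_eq (setoid_le_iff (r := Setoid.ker S).2 (fun x => propext (hS x).symm) hxy)

theorem isInvariant_sameCycle (f : Perm D) (x : D) : IsInvariant f (f.SameCycle x) :=
  fun _ => sameCycle_apply_right

theorem IsInvariant.mul {f g : Perm D} {S : D → Prop} (hf : IsInvariant f S)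
    (hg : IsInvariant g S) : IsInvariant (f * g) S :=
  fun x => (hf (g x)).trans (hg x)

theorem isInvariant_swap [DecidableEq D] {a b : D} {S : D → Prop} (h : S a ↔ S b) :
    IsInvariant (swap a b) S := by
  intro x
  by_cases ha : x = a
  · rw [ha, swap_apply_left, h]
  by_cases hb : x = b
  · rw [hb, swap_apply_right, h]
  · rw [swap_apply_of_ne_of_ne ha hb]

theorem isInvariant_map {f : Perm D} {g : Perm D'} {e : D ≃ D'} (h : ∀ x, e (f x) = g (e x))
    {S : D' → Prop} : IsInvariant f (S ∘ e) ↔ IsInvariant g S := by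
  rw [IsInvariant, IsInvariant, ← e.forall_congr_right]
  simp only [Function.comp_apply, h]

theorem sameCycle_map {f : Perm D} {g : Perm D'} (e : D ≃ D') (h : ∀ x, e (f x) = g (e x))
    (x y : D) : f.SameCycle x y ↔ g.SameCycle (e x) (e y) := by
  constructor
  · exact fun hxy => (((isInvariant_map h).2 (isInvariant_sameCycle g (e x))).iff_of_sameCycle
      hxy).1 (SameCycle.refl g (e x))
  · intro hxy
    have hS : IsInvariant g (f.SameCycle x ∘ e.symm) := by
      rw [← isInvariant_map h]
      simpa only [IsInvariant, Function.comp_apply, e.symm_apply_apply] using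
        isInvariant_sameCycle f x
    simpa only [Function.comp_apply, e.symm_apply_apply] using
      (hS.iff_of_sameCycle hxy).1 (by simp [SameCycle.refl])

theorem sameCycle_induction [Finite D] {f : Perm D} {S : D → Prop} (h : ∀ x, S x → S (f x))
    {x y : D} (hxy : f.SameCycle x y) (hx : S x) : S y := by
  obtain ⟨n, rfl⟩ := hxy.exists_nat_pow_eq
  clear hxy
  induction n with
  | zero => exact hx
  | succ k ih => rw [pow_succ', Perm.mul_apply]; exact h _ ih

theorem apply_iff_of_forall_ne [Finite D] {f : Perm D} {r : D} {S : D → Prop}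
    (h : ∀ x, f.SameCycle r x → x ≠ r → (S (f x) ↔ S x)) : S (f r) ↔ S r := by
  have propagate : ∀ T : D → Prop, (∀ x, f.SameCycle r x → x ≠ r → T x → T (f x)) →
      T (f r) → T r := by
    intro T hT hfr
    by_contra hr
    have hclosed : ∀ x, f.SameCycle r x ∧ T x → f.SameCycle r (f x) ∧ T (f x) := fun x hx =>
      ⟨sameCycle_apply_right.2 hx.1, hT x hx.1 (fun hxr => hr (hxr ▸ hx.2)) hx.2⟩
    exact hr (sameCycle_induction hclosed (sameCycle_apply_left.2 (SameCycle.refl f r))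
      ⟨sameCycle_apply_right.2 (SameCycle.refl f r), hfr⟩).2
  refine ⟨propagate S fun x hx hxr => (h x hx hxr).2, fun hr => ?_⟩
  by_contra hfr
  exact propagate (fun x => ¬ S x) (fun x hx hxr => mt (h x hx hxr).1) hfr hr

end Invariant

section Swap

variable {D : Type*} [DecidableEq D] {a b : D}

theorem setoid_swap_le_iff {r : Setoid D} : SameCycle.setoid (swap a b) ≤ r ↔ r a b := by
  refine ⟨fun h => h ⟨1, by simp⟩, fun h => setoid_le_iff.2 fun x => ?_⟩
  have h' : r x a ↔ r x b := ⟨fun hx => r.trans hx h, fun hx => r.trans hx (r.symm h)⟩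
  exact (isInvariant_swap (S := r x) h' x).2 (r.refl x)

theorem sup_setoid_swap_apply (s : Setoid D) (x y : D) :
    (s ⊔ SameCycle.setoid (swap a b)) x y ↔
      s x y ∨ ((s a x ∨ s b x) ∧ (s a y ∨ s b y)) := by
  set P : D → Prop := fun z => s x z ∨ ((s a x ∨ s b x) ∧ (s a z ∨ s b z))
  set t := s ⊔ SameCycle.setoid (swap a b)
  have hs : ∀ {u v}, s u v → t u v := fun h => (le_sup_left : s ≤ t) h
  have hab : t a b := (le_sup_right : SameCycle.setoid (swap a b) ≤ t) ⟨1, by simp⟩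
  constructor
  · intro hxy
    have hle : t ≤ Setoid.ker P := by
      refine sup_le (fun u v huv => propext ?_) (setoid_swap_le_iff.2 (propext ?_))
      · have hiff : ∀ w, s w u ↔ s w v := fun w =>
          ⟨fun h => s.trans h huv, fun h => s.trans h (s.symm huv)⟩
        simp only [P, hiff]
      · have := s.comm' (x := x) (y := a)
        have := s.comm' (x := x) (y := b)
        have := s.refl a
        have := s.refl b
        tauto
    exact (iff_of_eq (hle hxy)).1 (Or.inl (s.refl x))
  · rintro (h | ⟨hx | hx, hy | hy⟩)
    · exact hs h
    · exact hs (s.trans (s.symm hx) hy)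
    · exact t.trans (t.symm (hs hx)) (t.trans hab (hs hy))
    · exact t.trans (t.symm (hs hx)) (t.trans (t.symm hab) (hs hy))
    · exact hs (s.trans (s.symm hx) hy)

theorem card_quotient_sup_swap [Finite D] {s : Setoid D} (hab : ¬ s a b) :
    Nat.card (Quotient s) = Nat.card (Quotient (s ⊔ SameCycle.setoid (swap a b))) + 1 := by
  classical
  set t := s ⊔ SameCycle.setoid (swap a b)
  have ht := sup_setoid_swap_apply (a := a) (b := b) s
  let B : Quotient s := Quotient.mk s b
  let proj : {c : Quotient s // c ≠ B} → Quotient t :=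
    fun c => Quotient.map' id (fun _ _ h => (le_sup_left : s ≤ t) h) c.1
  have injective : Function.Injective proj := by
    rintro ⟨c, hc⟩ ⟨d, hd⟩ hcd
    induction c using Quotient.inductionOn with | _ x
    induction d using Quotient.inductionOn with | _ y
    have hx : ¬ s b x := fun hx => hc (Quotient.sound (s.symm hx))
    have hy : ¬ s b y := fun hy => hd (Quotient.sound (s.symm hy))
    refine Subtype.ext (Quotient.sound ?_)
    rcases (ht x y).1 (Quotient.exact hcd) with hxy | ⟨h1, h2⟩
    · exact hxy
    · exact s.trans (s.symm (h1.resolve_right hx)) (h2.resolve_right hy)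
  have surjective : Function.Surjective proj := by
    intro c
    induction c using Quotient.inductionOn with | _ x
    by_cases hx : s b x
    · exact ⟨⟨Quotient.mk s a, fun h => hab (Quotient.exact h)⟩,
        Quotient.sound ((ht a x).2 (Or.inr ⟨Or.inl (s.refl a), Or.inr hx⟩))⟩
    · exact ⟨⟨Quotient.mk s x, fun h => hx (s.symm (Quotient.exact h))⟩, rfl⟩
  rw [← Nat.card_congr (Equiv.ofBijective proj ⟨injective, surjective⟩),
    ← Nat.card_congr (Equiv.optionSubtypeNe B), Finite.card_option]

variable [Finite D] {f : Perm D}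

theorem sameCycle_swap_mul_self (h : ¬ f.SameCycle a b) : (swap a b * f).SameCycle a b := by
  set g := swap a b * f with hg
  have hclosed : ∀ x, f.SameCycle a x ∧ g.SameCycle a x →
      f.SameCycle a (f x) ∧ g.SameCycle a (f x) := by
    rintro x ⟨hfx, hgx⟩
    have hfx' : f.SameCycle a (f x) := sameCycle_apply_right.2 hfx
    refine ⟨hfx', ?_⟩
    by_cases ha : f x = a
    · rw [ha]
    · have hgx' : g x = f x :=
        swap_apply_of_ne_of_ne ha fun hb => h (hb ▸ hfx')
      rwa [← hgx', sameCycle_apply_right]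
  have hpred : g.SameCycle a (f⁻¹ a) :=
    (sameCycle_induction hclosed (⟨-1, by simp⟩ : f.SameCycle a (f⁻¹ a))
      ⟨SameCycle.refl f a, SameCycle.refl g a⟩).2
  simpa [hg] using sameCycle_apply_right.2 hpred

theorem setoid_swap_mul (h : ¬ f.SameCycle a b) :
    SameCycle.setoid (swap a b * f) = SameCycle.setoid f ⊔ SameCycle.setoid (swap a b) := by
  have hab : (swap a b * f).SameCycle a b := sameCycle_swap_mul_self h
  apply le_antisymm
  · refine setoid_le_iff.2 fun x => Setoid.trans' _ (y := f x) ?_ ?_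
    · exact le_sup_left (a := SameCycle.setoid f) (sameCycle_apply_right.2 (SameCycle.refl f x))
    · exact le_sup_right (b := SameCycle.setoid (swap a b))
        (sameCycle_apply_right.2 (SameCycle.refl _ _))
  · refine sup_le (setoid_le_iff.2 fun x => ?_) (setoid_swap_le_iff.2 hab)
    have hS : (swap a b * f).SameCycle x a ↔ (swap a b * f).SameCycle x b :=
      ⟨fun hx => hx.trans hab, fun hx => hx.trans hab.symm⟩
    exact (isInvariant_swap hS (f x)).1 (sameCycle_apply_right.2 (SameCycle.refl _ x))

theorem sameCycle_swap_mul_iff (h : ¬ f.SameCycle a b) (x y : D) :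
    (swap a b * f).SameCycle x y ↔ f.SameCycle x y ∨
      ((f.SameCycle a x ∨ f.SameCycle b x) ∧ (f.SameCycle a y ∨ f.SameCycle b y)) := by
  change SameCycle.setoid (swap a b * f) x y ↔ _
  rw [setoid_swap_mul h]
  exact sup_setoid_swap_apply _ x y

theorem not_sameCycle_swap_mul (h : f.SameCycle a b) (hab : a ≠ b) :
    ¬ (swap a b * f).SameCycle a b := by
  have hex : ∃ k : ℕ, (f ^ k) a = b := h.exists_nat_pow_eq
  set k := Nat.find hex
  have hkb : (f ^ k) a = b := Nat.find_spec hex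
  have hmin : ∀ j < k, (f ^ j) a ≠ b := fun j hj => Nat.find_min hex hj
  have hk : 0 < k := Nat.pos_of_ne_zero fun h0 => hab (by simpa [h0] using hkb)
  have hclosed : ∀ z, (∃ j < k, (f ^ j) a = z) →
      ∃ j < k, (f ^ j) a = (swap a b * f) z := by
    rintro _ ⟨j, hj, rfl⟩
    have hstep : (swap a b * f) ((f ^ j) a) = swap a b ((f ^ (j + 1)) a) := by
      rw [pow_succ', Perm.mul_apply, Perm.mul_apply]
    rcases (Nat.succ_le_of_lt hj).lt_or_eq with hlt | heq
    · refine ⟨j + 1, hlt, ?_⟩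
      have hne : (f ^ (j + 1)) a ≠ a := by
        intro hret
        apply hmin (k - (j + 1)) (by omega)
        calc (f ^ (k - (j + 1))) a = (f ^ (k - (j + 1))) ((f ^ (j + 1)) a) := by rw [hret]
          _ = b := by rw [← Perm.mul_apply, ← pow_add, Nat.sub_add_cancel hlt.le, hkb]
      rw [hstep, swap_apply_of_ne_of_ne hne (hmin _ hlt)]
    · exact ⟨0, hk, by rw [hstep, show j + 1 = k from heq, hkb, swap_apply_right]; rfl⟩
  intro hg
  obtain ⟨j, hj, hjb⟩ := sameCycle_induction hclosed hg ⟨0, hk, rfl⟩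
  exact hmin j hj hjb

theorem swap_mul_induction {P : Perm D → Prop} (one : P 1)
    (swap_mul : ∀ a b f, a ≠ b → f a = a → P f → P (swap a b * f)) (f : Perm D) : P f := by
  have := Fintype.ofFinite D
  induction hn : f.support.card using Nat.strong_induction_on generalizing f with
  | _ n ih =>
    by_cases hf : f = 1
    · rwa [hf]
    · obtain ⟨a, ha⟩ : ∃ a, f a ≠ a := not_forall.1 fun h => hf (Equiv.ext h)
      rw [← swap_mul_self_mul a (f a) f]
      exact swap_mul _ _ _ ha.symm (by simp) (ih _ (hn ▸ card_support_swap_mul ha) _ rfl)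

end Swap

end PermCycles

namespace PermCycles

open Equiv (Perm swap)
open Equiv.Perm

section NumCycles

variable {D D' : Type*}

/-- The number of cycles of a permutation, fixed points included. -/
noncomputable def numCycles (f : Perm D) : ℕ := Nat.card (Quotient (SameCycle.setoid f))

theorem numCycles_map {f : Perm D} {g : Perm D'} (e : D ≃ D') (h : ∀ x, e (f x) = g (e x)) :
    numCycles f = numCycles g :=
  Nat.card_congr (Quotient.congr e (sameCycle_map e h))

theorem numCycles_mul_comm (f g : Perm D) : numCycles (f * g) = numCycles (g * f) :=
  numCycles_map g fun _ => rfl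

theorem numCycles_one : numCycles (1 : Perm D) = Nat.card D :=
  (Nat.card_congr (Equiv.ofBijective (Quotient.mk _)
    ⟨fun _ _ h => sameCycle_one.1 (Quotient.exact h), Quot.mk_surjective⟩)).symm

variable [Finite D]

theorem numCycles_swap_mul_of_not_sameCycle [DecidableEq D] {f : Perm D} {a b : D}
    (h : ¬ f.SameCycle a b) : numCycles f = numCycles (swap a b * f) + 1 := by
  rw [numCycles, numCycles, setoid_swap_mul h]
  exact card_quotient_sup_swap h

theorem numCycles_swap_mul_of_sameCycle [DecidableEq D] {f : Perm D} {a b : D}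
    (h : f.SameCycle a b) (hab : a ≠ b) : numCycles (swap a b * f) = numCycles f + 1 := by
  have := numCycles_swap_mul_of_not_sameCycle (not_sameCycle_swap_mul h hab)
  rwa [Equiv.swap_mul_self_mul] at this

theorem card_eq_mul_numCycles {f : Perm D} {k : ℕ}
    (h : ∀ x, Nat.card {y // f.SameCycle x y} = k) : Nat.card D = k * numCycles f := by
  have := Fintype.ofFinite (Quotient (SameCycle.setoid f))
  have hfibre : ∀ c : Quotient (SameCycle.setoid f), Nat.card {y // Quotient.mk _ y = c} = k := by
    intro c
    induction c using Quotient.inductionOn with | _ x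
    rw [← h x]
    exact Nat.card_congr (Equiv.subtypeEquivRight fun y =>
      (Quotient.eq (r := SameCycle.setoid f)).trans sameCycle_comm)
  rw [← Nat.card_congr (Equiv.sigmaFiberEquiv (Quotient.mk (SameCycle.setoid f))), Nat.card_sigma,
    Finset.sum_congr rfl fun c _ => hfibre c, Finset.sum_const, Finset.card_univ,
    ← Nat.card_eq_fintype_card, smul_eq_mul, mul_comm]
  rfl

theorem card_sameCycle (f : Perm D) (d : D) :
    Nat.card {y // f.SameCycle d y} = Function.minimalPeriod f d := by
  have horbit : {y | f.SameCycle d y} = MulAction.orbit (Subgroup.zpowers f) d := by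
    ext y
    constructor
    · rintro ⟨n, rfl⟩
      exact ⟨⟨f ^ n, n, rfl⟩, rfl⟩
    · rintro ⟨⟨_, n, rfl⟩, rfl⟩
      exact ⟨n, rfl⟩
  have : Fintype (MulAction.orbit (Subgroup.zpowers f) d) := Fintype.ofFinite _
  have hcard := MulAction.minimalPeriod_eq_card (α := Perm D) (β := D) (a := f) (b := d)
  rw [← Nat.card_eq_fintype_card, ← horbit] at hcard
  exact hcard.symm

theorem card_sameCycle_eq_prime_iff {p : ℕ} (hp : p.Prime) {f : Perm D} {d : D} (h : f d ≠ d) :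
    Nat.card {y // f.SameCycle d y} = p ↔ f^[p] d = d := by
  rw [card_sameCycle]
  refine ⟨fun hper => hper ▸ Function.iterate_minimalPeriod, fun hper => ?_⟩
  exact ((Nat.dvd_prime hp).1 (Function.IsPeriodicPt.minimalPeriod_dvd hper)).resolve_left
    (mt Function.minimalPeriod_eq_one_iff_isFixedPt.1 h)

theorem lt_card_sameCycle_iff {k : ℕ} {f : Perm D} {d : D} :
    k < Nat.card {y // f.SameCycle d y} ↔ ∀ j, 0 < j → j ≤ k → f^[j] d ≠ d := by
  have hpos : 0 < Nat.card {y // f.SameCycle d y} :=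
    Nat.card_pos_iff.2 ⟨⟨d, SameCycle.refl f d⟩, inferInstance⟩
  rw [card_sameCycle] at hpos ⊢
  constructor
  · intro hk j hj hjk hper
    exact hk.not_ge ((Function.IsPeriodicPt.minimalPeriod_le hj hper).trans hjk)
  · intro h
    by_contra! hk
    exact h _ hpos hk Function.iterate_minimalPeriod

theorem two_le_card_sameCycle_iff {f : Perm D} {d : D} :
    2 ≤ Nat.card {y // f.SameCycle d y} ↔ f d ≠ d := by
  rw [Nat.succ_le_iff, lt_card_sameCycle_iff]
  refine ⟨fun h => h 1 one_pos le_rfl, fun h j hj hj1 => ?_⟩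
  obtain rfl : j = 1 := by omega
  exact h

theorem three_le_card_sameCycle_iff {f : Perm D} {d : D} :
    3 ≤ Nat.card {y // f.SameCycle d y} ↔ f d ≠ d ∧ f (f d) ≠ d := by
  rw [Nat.succ_le_iff, lt_card_sameCycle_iff]
  refine ⟨fun h => ⟨h 1 one_pos one_le_two, h 2 two_pos le_rfl⟩, fun ⟨h1, h2⟩ j hj hj2 => ?_⟩
  obtain rfl | rfl : j = 1 ∨ j = 2 := by omega
  · exact h1
  · exact h2

theorem two_mul_numCycles_of_involutive {α : Perm D} (hinvol : ∀ x, α (α x) = x)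
    (hne : ∀ x, α x ≠ x) : 2 * numCycles α = Nat.card D :=
  (card_eq_mul_numCycles fun x => (card_sameCycle_eq_prime_iff Nat.prime_two (hne x)).2
    (hinvol x)).symm

end NumCycles

section Sum

variable {D D' : Type*} (f : Perm D) (g : Perm D')

theorem isInvariant_sumCongr_iff {S : D ⊕ D' → Prop} :
    IsInvariant (sumCongr f g) S ↔ IsInvariant f (S ∘ Sum.inl) ∧ IsInvariant g (S ∘ Sum.inr) :=
  Sum.forall

theorem sameCycle_sumCongr_inl_inl {x y : D} :
    (sumCongr f g).SameCycle (Sum.inl x) (Sum.inl y) ↔ f.SameCycle x y := by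
  constructor
  · intro h
    have hS : IsInvariant (sumCongr f g) (Sum.elim (f.SameCycle x) fun _ => False) :=
      (isInvariant_sumCongr_iff f g).2 ⟨isInvariant_sameCycle f x, fun _ => Iff.rfl⟩
    exact (hS.iff_of_sameCycle h).1 (SameCycle.refl f x)
  · exact fun h => (((isInvariant_sumCongr_iff f g).1 (isInvariant_sameCycle _ (Sum.inl x))).1
      |>.iff_of_sameCycle h).1 (SameCycle.refl _ _)

theorem sameCycle_sumCongr_inr_inr {x y : D'} :
    (sumCongr f g).SameCycle (Sum.inr x) (Sum.inr y) ↔ g.SameCycle x y := by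
  have hcomm : ∀ z, Equiv.sumComm D D' (sumCongr f g z) = sumCongr g f (Equiv.sumComm D D' z) := by
    rintro (z | z) <;> rfl
  exact (sameCycle_map _ hcomm _ _).trans (sameCycle_sumCongr_inl_inl g f)

theorem not_sameCycle_sumCongr_inl_inr {x : D} {y : D'} :
    ¬ (sumCongr f g).SameCycle (Sum.inl x) (Sum.inr y) := by
  intro h
  have hS : IsInvariant (sumCongr f g) (Sum.elim (fun _ => True) fun _ => False) :=
    (isInvariant_sumCongr_iff f g).2 ⟨fun _ => Iff.rfl, fun _ => Iff.rfl⟩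
  exact (hS.iff_of_sameCycle h).1 trivial

theorem not_sameCycle_sumCongr_inr_inl {x : D} {y : D'} :
    ¬ (sumCongr f g).SameCycle (Sum.inr y) (Sum.inl x) :=
  fun h => not_sameCycle_sumCongr_inl_inr f g h.symm

theorem numCycles_sumCongr [Finite D] [Finite D'] :
    numCycles (sumCongr f g) = numCycles f + numCycles g := by
  let F : Quotient (SameCycle.setoid f) ⊕ Quotient (SameCycle.setoid g) →
      Quotient (SameCycle.setoid (sumCongr f g)) :=
    Sum.elim (Quotient.map' Sum.inl fun _ _ => (sameCycle_sumCongr_inl_inl f g).2)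
      (Quotient.map' Sum.inr fun _ _ => (sameCycle_sumCongr_inr_inr f g).2)
  have injective : Function.Injective F := by
    rintro (c | c) (d | d) h <;>
    induction c using Quotient.inductionOn <;>
    induction d using Quotient.inductionOn
    · exact congrArg Sum.inl (Quotient.sound ((sameCycle_sumCongr_inl_inl f g).1
        (Quotient.exact h)))
    · exact absurd (Quotient.exact h) (not_sameCycle_sumCongr_inl_inr f g)
    · exact absurd (Quotient.exact h) (not_sameCycle_sumCongr_inr_inl f g)
    · exact congrArg Sum.inr (Quotient.sound ((sameCycle_sumCongr_inr_inr f g).1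
        (Quotient.exact h)))
  have surjective : Function.Surjective F := by
    intro c
    induction c using Quotient.inductionOn with | _ x
    rcases x with x | x
    · exact ⟨Sum.inl (Quotient.mk _ x), rfl⟩
    · exact ⟨Sum.inr (Quotient.mk _ x), rfl⟩
  rw [numCycles, numCycles, numCycles, ← Nat.card_sum]
  exact (Nat.card_congr (Equiv.ofBijective F ⟨injective, surjective⟩)).symm

theorem exists_eq_equivSumCongr {A A' B B' : Type*} {e : A ⊕ B ≃ A' ⊕ B'}
    (hl : ∀ x, ∃ y, e (Sum.inl x) = Sum.inl y) (hr : ∀ x, ∃ y, e (Sum.inr x) = Sum.inr y) :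
    ∃ (e₁ : A ≃ A') (e₂ : B ≃ B'), e = Equiv.sumCongr e₁ e₂ := by
  choose f₁ hf₁ using hl
  choose f₂ hf₂ using hr
  have he : ⇑e = Sum.map f₁ f₂ := funext fun
    | Sum.inl x => hf₁ x
    | Sum.inr x => hf₂ x
  have hbij := Sum.map_bijective.1 (he ▸ e.bijective)
  exact ⟨Equiv.ofBijective f₁ hbij.1, Equiv.ofBijective f₂ hbij.2, Equiv.ext (congrFun he)⟩

theorem exists_eq_sumCongr_of_forall_inl [Finite D] [Finite D'] {h : Perm (D ⊕ D')}
    (hl : ∀ x, ∃ y, h (Sum.inl x) = Sum.inl y) :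
    ∃ (f : Perm D) (g : Perm D'), h = sumCongr f g := by
  have hrange : h ∈ (sumCongrHom D D').range :=
    mem_sumCongrHom_range_of_perm_mapsTo_inl (by
      rintro _ ⟨x, rfl⟩
      obtain ⟨y, hy⟩ := hl x
      exact ⟨y, hy.symm⟩)
  obtain ⟨⟨f, g⟩, hfg⟩ := hrange
  exact ⟨f, g, hfg.symm⟩

theorem exists_eq_sumCongr_of_forall_inr {g : Perm D'} {h : Perm (D ⊕ D')}
    (hr : ∀ y, h (Sum.inr y) = Sum.inr (g y)) : ∃ f : Perm D, h = sumCongr f g := by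
  have hl : ∀ x, ∃ y, h (Sum.inl x) = Sum.inl y := by
    intro x
    rcases hx : h (Sum.inl x) with y | y
    · exact ⟨y, rfl⟩
    · have : h (Sum.inr (g⁻¹ y)) = Sum.inr y := by simp [hr]
      exact absurd (h.injective (hx.trans this.symm)) Sum.inl_ne_inr
  obtain ⟨f, g', rfl⟩ := exists_eq_equivSumCongr hl fun y => ⟨_, hr y⟩
  obtain rfl : g' = g := Equiv.ext fun y => Sum.inr_injective (hr y)
  exact ⟨f, rfl⟩

end Sum

section Connected

variable {D : Type*}

/-- The equivalence relation whose classes are the orbits of the group generated by `σ` and `α`: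
for a rotation system, the connected components. -/
def conn (σ α : Perm D) : Setoid D := SameCycle.setoid σ ⊔ SameCycle.setoid α

theorem isInvariant_of_setoid_le {r : Setoid D} {f : Perm D} (h : SameCycle.setoid f ≤ r)
    (x : D) : IsInvariant f (r x) := fun z =>
  ⟨fun hz => r.trans hz (r.symm (setoid_le_iff.1 h z)), fun hz => r.trans hz (setoid_le_iff.1 h z)⟩

theorem isInvariant_left_conn (σ α : Perm D) (x : D) : IsInvariant σ (conn σ α x) :=
  isInvariant_of_setoid_le le_sup_left x

theorem isInvariant_right_conn (σ α : Perm D) (x : D) : IsInvariant α (conn σ α x) :=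
  isInvariant_of_setoid_le le_sup_right x

theorem conn_iff {σ α : Perm D} {x y : D} :
    conn σ α x y ↔ ∀ S, IsInvariant σ S → IsInvariant α S → (S x ↔ S y) := by
  constructor
  · intro h S hσ hα
    have hle : conn σ α ≤ Setoid.ker S :=
      sup_le (setoid_le_iff.2 fun z => propext (hσ z).symm)
        (setoid_le_iff.2 fun z => propext (hα z).symm)
    exact iff_of_eq (hle h)
  · intro h
    exact (h _ (isInvariant_left_conn σ α x) (isInvariant_right_conn σ α x)).1
      ((conn σ α).refl x)

theorem conn_iff_exists_mem_closure {σ α : Perm D} {x y : D} :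
    conn σ α x y ↔ ∃ g ∈ Subgroup.closure {σ, α}, g x = y := by
  constructor
  · have hle : conn σ α ≤ MulAction.orbitRel (Subgroup.closure {σ, α}) D := by
      refine sup_le (setoid_le_iff.2 fun z => Setoid.symm' _ ?_)
        (setoid_le_iff.2 fun z => Setoid.symm' _ ?_)
      · exact ⟨⟨σ, Subgroup.subset_closure (Or.inl rfl)⟩, rfl⟩
      · exact ⟨⟨α, Subgroup.subset_closure (Or.inr rfl)⟩, rfl⟩
    intro h
    obtain ⟨⟨g, hg⟩, hgx⟩ := hle ((conn σ α).symm h)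
    exact ⟨g, hg, hgx⟩
  · rintro ⟨g, hg, rfl⟩
    have hle : Subgroup.closure {σ, α} ≤ classPreserving (conn σ α) := by
      rw [Subgroup.closure_le]
      rintro τ (rfl | rfl)
      · exact setoid_le_iff.1 le_sup_left
      · exact setoid_le_iff.1 le_sup_right
    exact hle hg x

theorem card_quotient_conn_eq_one {σ α : Perm D} [Nonempty D] (h : ∀ x y, conn σ α x y) :
    Nat.card (Quotient (conn σ α)) = 1 := by
  refine Nat.card_eq_one_iff_unique.2 ⟨⟨?_⟩, ‹Nonempty D›.map (Quotient.mk _)⟩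
  rintro ⟨x⟩ ⟨y⟩
  exact Quotient.sound (h x y)

/-- The genus of a hypermap, connected or not, is nonnegative. -/
theorem numCycles_add_numCycles_add_numCycles_mul_le [Finite D] (σ α : Perm D) :
    numCycles σ + numCycles α + numCycles (α * σ) ≤
      Nat.card D + 2 * Nat.card (Quotient (conn σ α)) := by
  classical
  induction α using swap_mul_induction with
  | one =>
    have hconn : conn σ 1 = SameCycle.setoid σ :=
      sup_eq_left.2 (setoid_le_iff.2 fun x => Setoid.refl' _ x)
    rw [hconn, numCycles_one, one_mul]
    change _ ≤ _ + 2 * numCycles σ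
    omega
  | swap_mul a b β hab hβa ih =>
    have hβab : ¬ β.SameCycle a b := fun h => hab (h.eq_of_left hβa)
    have hβ := numCycles_swap_mul_of_not_sameCycle hβab
    have hconn : conn σ (swap a b * β) = conn σ β ⊔ SameCycle.setoid (swap a b) := by
      rw [conn, setoid_swap_mul hβab, ← sup_assoc, conn]
    rw [hconn, mul_assoc]
    by_cases h : conn σ β a b
    · have hle : numCycles (swap a b * (β * σ)) ≤ numCycles (β * σ) + 1 := by
        by_cases hφ : (β * σ).SameCycle a b
        · exact (numCycles_swap_mul_of_sameCycle hφ hab).le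
        · have := numCycles_swap_mul_of_not_sameCycle hφ
          omega
      rw [sup_eq_left.2 (setoid_swap_le_iff.2 h)]
      omega
    · have hφ : ¬ (β * σ).SameCycle a b := fun hφ =>
        h (conn_iff.2 fun S hσ hβ => (hβ.mul hσ).iff_of_sameCycle hφ)
      have := numCycles_swap_mul_of_not_sameCycle hφ
      have := card_quotient_sup_swap h
      omega

end Connected

end PermCycles

namespace RootedMap

open Equiv (Perm)
open Equiv.Perm PermCycles

section Darts

variable {D : Type*}

/-- The permutation whose cycles are the faces: it sends a dart to the next dart along the boundary
of the face on its right. -/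
def φ (M : RootedMap D) : Perm D := M.σ * M.α

theorem φ_apply (M : RootedMap D) (d : D) : M.φ d = M.σ (M.α d) := rfl

theorem conn_all (M : RootedMap D) (a b : D) : conn M.σ M.α a b :=
  conn_iff_exists_mem_closure.2 (M.connected a b)

theorem numCycles_euler (M : RootedMap D) :
    numCycles M.σ + numCycles M.φ = numCycles M.α + 2 :=
  M.euler

theorem sameCycle_φ_α (M : RootedMap D) (d : D) : M.σ.SameCycle (M.φ d) (M.α d) :=
  sameCycle_apply_left.2 (SameCycle.refl _ _)

theorem exists_origin_eq (M : RootedMap D) (v : M.Vertex) : ∃ d, M.origin d = v :=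
  Quotient.exists_rep v

theorem exists_rightFace_eq (M : RootedMap D) (f : M.Face) : ∃ d, M.rightFace d = f :=
  Quotient.exists_rep f

theorem forall_vertex_iff (M : RootedMap D) {p : M.Vertex → Prop} :
    (∀ v, p v) ↔ ∀ d, p (M.origin d) :=
  Quotient.forall

theorem origin_eq_iff (M : RootedMap D) {a b : D} :
    M.origin a = M.origin b ↔ M.σ.SameCycle a b := Quotient.eq

theorem rightFace_eq_iff (M : RootedMap D) {a b : D} :
    M.rightFace a = M.rightFace b ↔ M.φ.SameCycle a b := Quotient.eq

theorem vertexDegree_origin (M : RootedMap D) (d : D) :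
    M.vertexDegree (M.origin d) = Nat.card {y // M.σ.SameCycle d y} :=
  Nat.card_congr (Equiv.subtypeEquivRight fun _ => M.origin_eq_iff.trans sameCycle_comm)

theorem faceDegree_rightFace (M : RootedMap D) (d : D) :
    M.faceDegree (M.rightFace d) = Nat.card {y // M.φ.SameCycle d y} :=
  Nat.card_congr (Equiv.subtypeEquivRight fun _ => M.rightFace_eq_iff.trans sameCycle_comm)

theorem loopless_iff (M : RootedMap D) : M.Loopless ↔ ∀ d, ¬ M.σ.SameCycle d (M.α d) :=
  forall_congr' fun _ => not_congr (M.origin_eq_iff.trans sameCycle_comm)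

/-- A set `S` of darts which, outside the vertex `c`, is a union of connected components of the map
with the vertex `c` deleted. The vertex `c` is given by one of its darts. -/
structure IsUnionOff (M : RootedMap D) (c : D) (S : D → Prop) : Prop where
  σ : IsInvariant M.σ S
  α : ∀ x, ¬ M.σ.SameCycle c x → ¬ M.σ.SameCycle c (M.α x) → (S (M.α x) ↔ S x)

/-- The map is a near-triangulation, in terms of darts: see `isNearTriangulation_iff`. -/
def InternalTriangles (M : RootedMap D) : Prop :=
  ∀ d, ¬ M.φ.SameCycle M.root d → M.φ (M.φ (M.φ d)) = d

/-- The class `T`, in terms of darts: see `isT_iff`. -/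
structure IsTD (M : RootedMap D) : Prop where
  loopless : ∀ d, ¬ M.σ.SameCycle d (M.α d)
  nonsep : ∀ {c S}, M.IsUnionOff c S →
    ∀ {a b}, ¬ M.σ.SameCycle c a → ¬ M.σ.SameCycle c b → (S a ↔ S b)
  tri : M.InternalTriangles
  deg : ∀ d, (∀ y, M.φ.SameCycle M.root y → ¬ M.σ.SameCycle d y) →
    M.σ d ≠ d ∧ M.σ (M.σ d) ≠ d

theorem origin_mem_compl_iff (M : RootedMap D) {c x : D} :
    M.origin x ∈ ({M.origin c}ᶜ : Set M.Vertex) ↔ ¬ M.σ.SameCycle c x :=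
  not_congr (M.origin_eq_iff.trans sameCycle_comm)

theorem IsUnionOff.of_sameCycle {M : RootedMap D} {c d : D} {S : D → Prop}
    (hS : M.IsUnionOff c S) (hcd : M.σ.SameCycle d c) : M.IsUnionOff d S where
  σ := hS.σ
  α x hx hαx := hS.α x (fun h => hx (hcd.trans h)) fun h => hαx (hcd.trans h)

theorem IsUnionOff.iff_of_reachable {M : RootedMap D} {c : D} {S : D → Prop}
    (hS : M.IsUnionOff c S) {a b : D} {ha : M.origin a ∈ ({M.origin c}ᶜ : Set M.Vertex)}
    {hb : M.origin b ∈ ({M.origin c}ᶜ : Set M.Vertex)}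
    (h : (M.graph.induce {M.origin c}ᶜ).Reachable ⟨M.origin a, ha⟩ ⟨M.origin b, hb⟩) :
    S a ↔ S b := by
  let T : M.Vertex → Prop := Quotient.lift S fun x y hxy => propext (hS.σ.iff_of_sameCycle hxy)
  have hwalk : ∀ u v : ({M.origin c}ᶜ : Set M.Vertex),
      (M.graph.induce {M.origin c}ᶜ).Walk u v → (T u.1 ↔ T v.1) := by
    intro u v w
    induction w with
    | nil => rfl
    | @cons u v w huv _ ih =>
      rw [← ih]
      obtain ⟨u, hu⟩ := u
      obtain ⟨v, hv⟩ := v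
      obtain ⟨_, d, rfl, rfl⟩ := huv
      exact (hS.α d (M.origin_mem_compl_iff.1 hu) (M.origin_mem_compl_iff.1 hv)).symm
  obtain ⟨w⟩ := h
  exact hwalk _ _ w

theorem isUnionOff_reachable (M : RootedMap D) (c : D)
    (u : ({M.origin c}ᶜ : Set M.Vertex)) :
    M.IsUnionOff c fun z => ∃ hz : M.origin z ∈ ({M.origin c}ᶜ : Set M.Vertex),
      (M.graph.induce {M.origin c}ᶜ).Reachable u ⟨M.origin z, hz⟩ where
  σ x := by
    have : M.origin (M.σ x) = M.origin x :=
      M.origin_eq_iff.2 (sameCycle_apply_left.2 (SameCycle.refl _ _))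
    simp only [this]
  α x hx hαx := by
    simp only [M.origin_mem_compl_iff.2 hx, M.origin_mem_compl_iff.2 hαx, exists_true_left]
    by_cases he : M.origin x = M.origin (M.α x)
    · simp only [he]
    · have hadj : (M.graph.induce {M.origin c}ᶜ).Adj ⟨M.origin x, M.origin_mem_compl_iff.2 hx⟩
          ⟨M.origin (M.α x), M.origin_mem_compl_iff.2 hαx⟩ := ⟨he, x, rfl, rfl⟩
      exact ⟨fun h => h.trans hadj.symm.reachable, fun h => h.trans hadj.reachable⟩

theorem preconnected_iff (M : RootedMap D) (c : D) :
    (M.graph.induce {M.origin c}ᶜ).Preconnected ↔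
      ∀ {S}, M.IsUnionOff c S →
        ∀ {a b}, ¬ M.σ.SameCycle c a → ¬ M.σ.SameCycle c b → (S a ↔ S b) := by
  constructor
  · intro h S hS a b ha hb
    exact hS.iff_of_reachable
      (h ⟨_, M.origin_mem_compl_iff.2 ha⟩ ⟨_, M.origin_mem_compl_iff.2 hb⟩)
  · rintro h ⟨u, hu⟩ ⟨v, hv⟩
    obtain ⟨a, rfl⟩ := M.exists_origin_eq u
    obtain ⟨b, rfl⟩ := M.exists_origin_eq v
    exact ((h (M.isUnionOff_reachable c ⟨M.origin a, hu⟩) (M.origin_mem_compl_iff.1 hu)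
      (M.origin_mem_compl_iff.1 hv)).1 ⟨hu, SimpleGraph.Reachable.refl _⟩).2

theorem isExternal_origin_iff (M : RootedMap D) {d : D} :
    M.IsExternal (M.origin d) ↔ ∃ y, M.φ.SameCycle M.root y ∧ M.σ.SameCycle d y :=
  exists_congr fun _ => and_congr (M.rightFace_eq_iff.trans sameCycle_comm)
    (M.origin_eq_iff.trans sameCycle_comm)

variable [Finite D]

theorem isNearTriangulation_iff {M : RootedMap D} (hM : ∀ d, ¬ M.σ.SameCycle d (M.α d)) :
    M.IsNearTriangulation ↔ M.InternalTriangles := by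
  have hdegree : ∀ d, M.faceDegree (M.rightFace d) = 3 ↔ M.φ (M.φ (M.φ d)) = d := fun d => by
    have hne : M.φ d ≠ d := fun h => hM d (by simpa only [h] using M.sameCycle_φ_α d)
    rw [faceDegree_rightFace, card_sameCycle_eq_prime_iff Nat.prime_three hne]
    rfl
  have hroot : ∀ d, M.rightFace d = M.rootFace ↔ M.φ.SameCycle M.root d :=
    fun d => M.rightFace_eq_iff.trans sameCycle_comm
  constructor
  · exact fun h d hd => (hdegree d).1 (h _ (mt (hroot d).1 hd))
  · intro h f hd
    obtain ⟨d, rfl⟩ := M.exists_rightFace_eq f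
    exact (hdegree d).2 (h d (mt (hroot d).2 hd))

theorem forall_internal_three_le_vertexDegree_iff (M : RootedMap D) :
    (∀ v : M.Vertex, ¬ M.IsExternal v → 3 ≤ M.vertexDegree v) ↔
      ∀ d, (∀ y, M.φ.SameCycle M.root y → ¬ M.σ.SameCycle d y) →
        M.σ d ≠ d ∧ M.σ (M.σ d) ≠ d := by
  have hdart : ∀ d, (¬ M.IsExternal (M.origin d) → 3 ≤ M.vertexDegree (M.origin d)) ↔
      ((∀ y, M.φ.SameCycle M.root y → ¬ M.σ.SameCycle d y) → M.σ d ≠ d ∧ M.σ (M.σ d) ≠ d) := by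
    intro d
    rw [isExternal_origin_iff, vertexDegree_origin, three_le_card_sameCycle_iff]
    simp only [not_exists, not_and]
  exact M.forall_vertex_iff.trans (forall_congr' hdart)

theorem isT_iff (M : RootedMap D) : M.IsT ↔ M.IsTD := by
  have hnonsep : (∀ v : M.Vertex, (M.graph.induce {v}ᶜ).Preconnected) ↔
      ∀ c, (M.graph.induce {M.origin c}ᶜ).Preconnected := M.forall_vertex_iff
  constructor
  · rintro ⟨⟨hloop, hsep⟩, htri, hdeg⟩
    rw [loopless_iff] at hloop
    exact ⟨hloop, fun {c _} => (M.preconnected_iff c).1 (hnonsep.1 hsep c),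
      (isNearTriangulation_iff hloop).1 htri, M.forall_internal_three_le_vertexDegree_iff.1 hdeg⟩
  · rintro ⟨hloop, hsep, htri, hdeg⟩
    exact ⟨⟨M.loopless_iff.2 hloop, hnonsep.2 fun c => (M.preconnected_iff c).2 hsep⟩,
      (isNearTriangulation_iff hloop).2 htri, M.forall_internal_three_le_vertexDegree_iff.2 hdeg⟩

end Darts

end RootedMap

namespace RootedMap

open Equiv (Perm swap swap_apply_of_ne_of_ne)
open Equiv.Perm PermCycles

section Iso

variable {D D' D'' : Type*} {M : RootedMap D} {N : RootedMap D'} {P : RootedMap D''}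

theorem Iso.refl (M : RootedMap D) : M.Iso M :=
  ⟨Equiv.refl _, fun _ => rfl, fun _ => rfl, rfl⟩

theorem Iso.symm (h : M.Iso N) : N.Iso M := by
  obtain ⟨e, hσ, hα, hroot⟩ := h
  exact ⟨e.symm, fun d => by rw [Equiv.symm_apply_eq, hσ, Equiv.apply_symm_apply],
    fun d => by rw [Equiv.symm_apply_eq, hα, Equiv.apply_symm_apply],
    by rw [Equiv.symm_apply_eq, hroot]⟩

theorem Iso.trans (h : M.Iso N) (h' : N.Iso P) : M.Iso P := by
  obtain ⟨e, hσ, hα, hroot⟩ := h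
  obtain ⟨e', hσ', hα', hroot'⟩ := h'
  exact ⟨e.trans e', fun d => (congrArg e' (hσ d)).trans (hσ' _),
    fun d => (congrArg e' (hα d)).trans (hα' _), (congrArg e' hroot).trans hroot'⟩

theorem map_φ {e : D ≃ D'} (hσ : ∀ d, e (M.σ d) = N.σ (e d)) (hα : ∀ d, e (M.α d) = N.α (e d))
    (d : D) : e (M.φ d) = N.φ (e d) := by
  rw [φ_apply, φ_apply, hσ, hα]

theorem IsTD.of_iso (h : M.Iso N) (hM : M.IsTD) : N.IsTD := by
  obtain ⟨e, hσ, hα, hroot⟩ := h.symm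
  have hφ := map_φ hσ hα
  have hσ' := sameCycle_map e hσ
  have hφ' := sameCycle_map e hφ
  refine ⟨fun d => ?_, fun {c S} hS {a b} ha hb => ?_, fun d hd => ?_, fun d hd => ?_⟩
  · rw [hσ', hα]
    exact hM.loopless _
  · have hS' : M.IsUnionOff (e c) (S ∘ e.symm) := by
      refine ⟨(isInvariant_map hσ).1 (by simpa [Function.comp_def] using hS.σ), fun x => ?_⟩
      obtain ⟨y, rfl⟩ := e.surjective x
      rw [← hα, ← hσ', ← hσ']
      simpa using hS.α y
    rw [hσ'] at ha hb
    simpa using hM.nonsep hS' ha hb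
  · rw [hφ', hroot] at hd
    apply e.injective
    rw [hφ, hφ, hφ]
    exact hM.tri _ hd
  · have := hM.deg (e d) fun y hy => by
      obtain ⟨z, rfl⟩ := e.surjective y
      rw [← hσ']
      exact hd z (by rwa [hφ', hroot])
    rwa [← hσ, ← hσ, e.injective.ne_iff, e.injective.ne_iff] at this

/-- Transport of a map along a bijection of the darts. -/
def transport (M : RootedMap D) (e : D ≃ D') : RootedMap D' where
  σ := (e.symm.trans M.σ).trans e
  α := (e.symm.trans M.α).trans e
  root := e M.root
  α_invol d := by simp [M.α_invol]
  α_ne d := by simp [← Equiv.eq_symm_apply, M.α_ne]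
  connected a b := by
    refine conn_iff_exists_mem_closure.1 (conn_iff.2 fun S hσ hα => ?_)
    have := conn_iff.1 (M.conn_all (e.symm a) (e.symm b)) (S ∘ e)
      ((isInvariant_map (by simp)).2 hσ) ((isInvariant_map (by simp)).2 hα)
    simpa using this
  euler := by
    have := M.numCycles_euler
    rw [numCycles_map (f := M.σ) (g := (e.symm.trans M.σ).trans e) e (by simp),
      numCycles_map (f := M.α) (g := (e.symm.trans M.α).trans e) e (by simp),
      numCycles_map (f := M.φ) (g := (e.symm.trans M.σ).trans e * (e.symm.trans M.α).trans e) e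
        (by simp [φ_apply])] at this
    exact this

theorem iso_transport (M : RootedMap D) (e : D ≃ D') : M.Iso (M.transport e) :=
  ⟨e, fun d => by simp [transport], fun d => by simp [transport], rfl⟩

/-- The same map with another root. -/
def reroot (M : RootedMap D) (r : D) : RootedMap D := { M with root := r }

theorem IsTD.reroot (h : M.IsTD) {r : D} (hr : M.φ.SameCycle M.root r) : (M.reroot r).IsTD where
  loopless := h.loopless
  nonsep hS := h.nonsep ⟨hS.σ, hS.α⟩
  tri d hd := h.tri d fun h' => hd (hr.symm.trans h')
  deg d hd := h.deg d fun y hy => hd y (hr.symm.trans hy)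

end Iso

section Jordan

variable {D : Type*} {M : RootedMap D}

theorem two_mul_numCycles_α [Finite D] (M : RootedMap D) : 2 * numCycles M.α = Nat.card D :=
  two_mul_numCycles_of_involutive M.α_invol M.α_ne

/-- The Jordan curve theorem: cutting a planar map at two corners of a vertex that lie in the same
face disconnects it. -/
theorem not_conn_swap_mul [Finite D] [DecidableEq D] (M : RootedMap D) {a b : D} (hab : a ≠ b)
    (hσ : M.σ.SameCycle a b) (hφ : M.φ.SameCycle a b) :
    ¬ conn (swap a b * M.σ) M.α a b := by
  intro hcut
  have : Nonempty D := ⟨a⟩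
  have hconn : ∀ x y, conn (swap a b * M.σ) M.α x y := fun x y =>
    conn_iff.2 fun S hS hα => conn_iff.1 (M.conn_all x y) S
      (fun z => (isInvariant_swap (conn_iff.1 hcut S hS hα) (M.σ z)).symm.trans (hS z)) hα
  have hgenus := numCycles_add_numCycles_add_numCycles_mul_le (swap a b * M.σ) M.α
  rw [card_quotient_conn_eq_one hconn, numCycles_mul_comm M.α, mul_assoc, ← φ,
    numCycles_swap_mul_of_sameCycle hσ hab, numCycles_swap_mul_of_sameCycle hφ hab] at hgenus
  have := M.numCycles_euler
  have := M.two_mul_numCycles_α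
  omega

/-- A face of a nonseparable map visits each vertex at most once: otherwise the part of the map on
one side of a closed curve through the vertex and the face is cut off by deleting the vertex. -/
theorem IsTD.eq_of_sameCycle [Finite D] (h : M.IsTD) {a b : D}
    (hσ : M.σ.SameCycle a b) (hφ : M.φ.SameCycle a b) : a = b := by
  classical
  by_contra hab
  refine M.not_conn_swap_mul hab hσ hφ (conn_iff.2 fun P hcut hα => ?_)
  have hαoff : ∀ {x}, M.σ.SameCycle a x → ¬ M.σ.SameCycle a (M.α x) := fun hx hαx =>
    h.loopless _ (hx.symm.trans hαx)
  have hunion : M.IsUnionOff a fun x => P x ∧ ¬ M.σ.SameCycle a x := by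
    refine ⟨fun x => ?_, fun x hx hαx => by simp only [hx, hαx, hα x]⟩
    rw [sameCycle_apply_right]
    refine and_congr_left fun hx => ?_
    have hσx : ∀ {y}, M.σ.SameCycle a y → M.σ x ≠ y := fun hy hxy =>
      hx (sameCycle_apply_right.1 (hxy ▸ hy))
    rw [← hcut x, Perm.mul_apply, swap_apply_of_ne_of_ne (hσx (SameCycle.refl _ _)) (hσx hσ)]
  simpa only [hα a, hα b, hαoff (SameCycle.refl _ _), hαoff hσ, not_false_eq_true, and_true] using
    h.nonsep hunion (hαoff (SameCycle.refl _ _)) (hαoff hσ)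

/-- Deleting the other end of the edge of `a` isolates `a`. -/
theorem IsTD.eq_or_eq_of_apply_eq (h : M.IsTD) {a : D} (ha : M.σ a = a) (x : D) :
    x = a ∨ x = M.α a := by
  have hunion : M.IsUnionOff (M.α a) (· = a) := by
    refine ⟨fun x => by simpa only [ha] using M.σ.injective.eq_iff (b := a), fun x hx hαx => ?_⟩
    exact ⟨fun hxa => absurd (hxa ▸ (M.α_invol x).symm ▸ SameCycle.refl _ _) hx,
      fun hxa => absurd (hxa ▸ SameCycle.refl _ _) hαx⟩
  have hoff : ∀ y, ¬ M.σ.SameCycle (M.α a) y → y = a := fun y hy =>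
    (h.nonsep hunion (fun h' => h.loopless a h'.symm) hy).1 rfl
  by_cases hx : M.σ.SameCycle (M.α a) x
  · right
    rw [← hoff (M.α x) fun hαx => h.loopless x (hx.symm.trans hαx), M.α_invol]
  · exact Or.inl (hoff x hx)

theorem IsTD.φ_ne (h : M.IsTD) (d : D) : M.φ d ≠ d := fun hd =>
  h.loopless d (by simpa only [hd] using M.sameCycle_φ_α d)

end Jordan

end RootedMap

namespace PermCycles

open Equiv (Perm swap swap_apply_left swap_apply_right swap_apply_of_ne_of_ne)
open Equiv.Perm

section Close

variable {D : Type*}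

open scoped Classical in
/-- The rotation system obtained from `σ` by inserting the dart `true` just before `p` and the dart
`false` just before `w`, where `p ≠ w`. -/
noncomputable def closeσ (σ : Perm D) (p w : D) : Perm (D ⊕ Bool) :=
  swap (Sum.inr true) (Sum.inl p) * (swap (Sum.inr false) (Sum.inl w) * sumCongr σ 1)

/-- The involution `α` extended by a new edge. -/
def closeα (α : Perm D) : Perm (D ⊕ Bool) := sumCongr α Equiv.boolNot

/-- Sends the two new darts of `closeσ σ p w` to the old ones that follow them. -/
def retract (p w : D) : D ⊕ Bool → D := Sum.elim id fun b => if b then p else w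

@[simp] theorem retract_inl (p w x : D) : retract p w (Sum.inl x) = x := rfl
@[simp] theorem retract_true (p w : D) : retract p w (Sum.inr true) = p := rfl
@[simp] theorem retract_false (p w : D) : retract p w (Sum.inr false) = w := rfl

@[simp] theorem closeα_inl (α : Perm D) (x : D) : closeα α (Sum.inl x) = Sum.inl (α x) := rfl
@[simp] theorem closeα_true (α : Perm D) : closeα α (Sum.inr true) = Sum.inr false := rfl
@[simp] theorem closeα_false (α : Perm D) : closeα α (Sum.inr false) = Sum.inr true := rfl

variable (σ α : Perm D) {p w : D}

@[simp] theorem closeσ_true : closeσ σ p w (Sum.inr true) = Sum.inl p := by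
  classical
  simp only [closeσ, Perm.mul_apply, sumCongr_apply, Sum.map_inr, Perm.one_apply]
  rw [swap_apply_of_ne_of_ne (a := Sum.inr false) (by simp) (by simp), swap_apply_left]

theorem closeσ_false (hpw : p ≠ w) : closeσ σ p w (Sum.inr false) = Sum.inl w := by
  classical
  simp only [closeσ, Perm.mul_apply, sumCongr_apply, Sum.map_inr, Perm.one_apply]
  rw [swap_apply_left, swap_apply_of_ne_of_ne (by simp) (by simpa using hpw.symm)]

theorem closeσ_inl_of_eq_right {x : D} (hx : σ x = w) :
    closeσ σ p w (Sum.inl x) = Sum.inr false := by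
  classical
  simp only [closeσ, Perm.mul_apply, sumCongr_apply, Sum.map_inl, hx]
  rw [swap_apply_right, swap_apply_of_ne_of_ne (by simp) (by simp)]

theorem closeσ_inl_of_eq_left (hpw : p ≠ w) {x : D} (hx : σ x = p) :
    closeσ σ p w (Sum.inl x) = Sum.inr true := by
  classical
  simp only [closeσ, Perm.mul_apply, sumCongr_apply, Sum.map_inl, hx]
  rw [swap_apply_of_ne_of_ne (a := Sum.inr false) (by simp) (by simpa using hpw), swap_apply_right]

theorem closeσ_inl_of_ne {x : D} (hw : σ x ≠ w) (hp : σ x ≠ p) :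
    closeσ σ p w (Sum.inl x) = Sum.inl (σ x) := by
  classical
  simp only [closeσ, Perm.mul_apply, sumCongr_apply, Sum.map_inl]
  rw [swap_apply_of_ne_of_ne (a := Sum.inr false) (by simp) (by simpa using hw),
    swap_apply_of_ne_of_ne (by simp) (by simpa using hp)]

theorem closeσ_inl_cases (hpw : p ≠ w) (x : D) :
    (σ x = w ∧ closeσ σ p w (Sum.inl x) = Sum.inr false) ∨
    (σ x = p ∧ closeσ σ p w (Sum.inl x) = Sum.inr true) ∨
    (σ x ≠ w ∧ σ x ≠ p ∧ closeσ σ p w (Sum.inl x) = Sum.inl (σ x)) := by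
  by_cases hw : σ x = w
  · exact Or.inl ⟨hw, closeσ_inl_of_eq_right σ hw⟩
  by_cases hp : σ x = p
  · exact Or.inr (Or.inl ⟨hp, closeσ_inl_of_eq_left σ hpw hp⟩)
  · exact Or.inr (Or.inr ⟨hw, hp, closeσ_inl_of_ne σ hw hp⟩)

theorem retract_closeσ_inl (hpw : p ≠ w) (x : D) :
    retract p w (closeσ σ p w (Sum.inl x)) = σ x := by
  rcases closeσ_inl_cases σ hpw x with ⟨hx, h⟩ | ⟨hx, h⟩ | ⟨_, _, h⟩ <;> rw [h]
  · exact hx.symm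
  · exact hx.symm
  · rfl

variable {σ}

theorem IsInvariant.comp_retract (hpw : p ≠ w) {S : D → Prop} (hS : IsInvariant σ S) :
    IsInvariant (closeσ σ p w) (S ∘ retract p w) := by
  rintro (x | (_ | _)) <;> rw [Function.comp_apply, Function.comp_apply]
  · rw [retract_closeσ_inl σ hpw, hS, retract_inl]
  · rw [closeσ_false σ hpw, retract_inl, retract_false]
  · rw [closeσ_true, retract_inl, retract_true]

theorem IsInvariant.iff_inl_retract (hpw : p ≠ w) {S : D ⊕ Bool → Prop}
    (hS : IsInvariant (closeσ σ p w) S) (u : D ⊕ Bool) : S u ↔ S (Sum.inl (retract p w u)) := by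
  rcases u with x | (_ | _)
  · rfl
  · rw [← hS (Sum.inr false), closeσ_false σ hpw, retract_false]
  · rw [← hS (Sum.inr true), closeσ_true, retract_true]

theorem IsInvariant.comp_inl_of_closeσ (hpw : p ≠ w) {S : D ⊕ Bool → Prop}
    (hS : IsInvariant (closeσ σ p w) S) : IsInvariant σ (S ∘ Sum.inl) := fun x => by
  have h := hS.iff_inl_retract hpw (closeσ σ p w (Sum.inl x))
  rw [retract_closeσ_inl σ hpw] at h
  exact h.symm.trans (hS (Sum.inl x))

variable (σ)

theorem sameCycle_closeσ (hpw : p ≠ w) (u v : D ⊕ Bool) :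
    (closeσ σ p w).SameCycle u v ↔ σ.SameCycle (retract p w u) (retract p w v) := by
  constructor
  · exact fun h => (((isInvariant_sameCycle σ (retract p w u)).comp_retract hpw).iff_of_sameCycle
      h).1 (SameCycle.refl _ _)
  · intro h
    have hS := isInvariant_sameCycle (closeσ σ p w) u
    rw [hS.iff_inl_retract hpw]
    exact ((hS.comp_inl_of_closeσ hpw).iff_of_sameCycle h).1
      ((hS.iff_inl_retract hpw u).1 (SameCycle.refl _ _))

variable {σ} in
theorem exists_eq_closeσ {τ : Perm (D ⊕ Bool)} (hp : τ (Sum.inr true) = Sum.inl p)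
    (hw : τ (Sum.inr false) = Sum.inl w) : ∃ σ, τ = closeσ σ p w := by
  classical
  have hpw : p ≠ w := by
    rintro rfl
    simpa using τ.injective (hp.trans hw.symm)
  obtain ⟨σ, hσ⟩ := exists_eq_sumCongr_of_forall_inr (g := 1)
    (h := swap (Sum.inr false) (Sum.inl w) * (swap (Sum.inr true) (Sum.inl p) * τ)) (by
      rintro (_ | _) <;> simp only [Perm.mul_apply, Perm.one_apply]
      · rw [hw, swap_apply_of_ne_of_ne (a := Sum.inr true) (by simp) (by simpa using hpw.symm),
          swap_apply_right]
      · rw [hp, swap_apply_right, swap_apply_of_ne_of_ne (by simp) (by simp)])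
  refine ⟨σ, ?_⟩
  rw [closeσ, ← hσ, Equiv.swap_mul_self_mul, Equiv.swap_mul_self_mul]

theorem exists_eq_closeα {β : Perm (D ⊕ Bool)} (htrue : β (Sum.inr true) = Sum.inr false)
    (hfalse : β (Sum.inr false) = Sum.inr true) : ∃ α, β = closeα α :=
  exists_eq_sumCongr_of_forall_inr (Bool.forall_bool.2 ⟨hfalse, htrue⟩)

theorem apply_apply_eq_of_closeσ_triangle (hpw : p ≠ w)
    (h : (closeσ σ p w * closeα α) ((closeσ σ p w * closeα α) (Sum.inl p)) = Sum.inr false) :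
    (σ * α) ((σ * α) p) = w := by
  simp only [Perm.mul_apply, closeα_inl] at h ⊢
  rcases closeσ_inl_cases σ hpw (α p) with ⟨_, hp⟩ | ⟨_, hp⟩ | ⟨_, _, hp⟩
  · rw [hp, closeα_false, closeσ_true] at h
    exact absurd h Sum.inl_ne_inr
  · rw [hp, closeα_true, closeσ_false σ hpw] at h
    exact absurd h Sum.inl_ne_inr
  · rw [hp, closeα_inl] at h
    rcases closeσ_inl_cases σ hpw (α (σ (α p))) with ⟨hw, _⟩ | ⟨_, hpp⟩ | ⟨_, _, hpp⟩
    · exact hw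
    · simp [hpp] at h
    · simp [hpp] at h

variable [Finite D]

theorem numCycles_closeσ : numCycles (closeσ σ p w) = numCycles σ := by
  classical
  have hw := not_sameCycle_sumCongr_inr_inl σ (1 : Perm Bool) (x := w) (y := false)
  have hp : ¬ (swap (Sum.inr false) (Sum.inl w) * sumCongr σ (1 : Perm Bool)).SameCycle
      (Sum.inr true) (Sum.inl p) := by
    rw [sameCycle_swap_mul_iff hw, sameCycle_sumCongr_inr_inr, sameCycle_one]
    simp [not_sameCycle_sumCongr_inr_inl, not_sameCycle_sumCongr_inl_inr]
  have hsum : numCycles (sumCongr σ (1 : Perm Bool)) = numCycles σ + 2 := by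
    rw [numCycles_sumCongr, numCycles_one, Nat.card_eq_fintype_card, Fintype.card_bool]
  have hfalse := numCycles_swap_mul_of_not_sameCycle hw
  have htrue := numCycles_swap_mul_of_not_sameCycle hp
  rw [closeσ]
  convert_to numCycles _ = _ at htrue
  omega

theorem numCycles_boolNot : numCycles (Equiv.boolNot : Perm Bool) = 1 := by
  have := two_mul_numCycles_of_involutive (α := (Equiv.boolNot : Perm Bool)) (by simp) (by simp)
  rw [Nat.card_eq_fintype_card, Fintype.card_bool] at this
  omega

theorem numCycles_closeα : numCycles (closeα α) = numCycles α + 1 := by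
  rw [closeα, numCycles_sumCongr, numCycles_boolNot]

theorem numCycles_closeσ_mul_closeα (h : (σ * α).SameCycle w p) :
    numCycles (closeσ σ p w * closeα α) = numCycles (σ * α) + 1 := by
  classical
  have hmul : closeσ σ p w * closeα α = swap (Sum.inr true) (Sum.inl p) *
      (swap (Sum.inr false) (Sum.inl w) * sumCongr (σ * α) Equiv.boolNot) := by
    rw [closeσ, closeα, mul_assoc, mul_assoc, sumCongr_mul, one_mul]
  have hfalse := not_sameCycle_sumCongr_inr_inl (σ * α) Equiv.boolNot (x := w) (y := false)
  have htrue : (swap (Sum.inr false) (Sum.inl w) * sumCongr (σ * α) Equiv.boolNot).SameCycle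
      (Sum.inr true) (Sum.inl p) := by
    rw [sameCycle_swap_mul_iff hfalse, sameCycle_sumCongr_inr_inr, sameCycle_sumCongr_inl_inl]
    exact Or.inr ⟨Or.inl ⟨1, by simp⟩, Or.inr h⟩
  rw [hmul, numCycles_swap_mul_of_sameCycle htrue Sum.inr_ne_inl,
    ← numCycles_swap_mul_of_not_sameCycle hfalse, numCycles_sumCongr, numCycles_boolNot]

end Close

end PermCycles

namespace RootedMap

open Equiv (Perm swap)
open Equiv.Perm PermCycles

universe u

section Close

variable {D : Type u} {D' : Type*}

/-- The map with a single edge, joining two vertices. -/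
def single : RootedMap Bool where
  σ := 1
  α := Equiv.boolNot
  root := true
  α_invol := by simp
  α_ne := by simp
  connected a b := conn_iff_exists_mem_closure.1 (conn_iff.2 fun S _ hα => by
    have := hα true
    revert a b
    simpa [Bool.forall_bool, iff_comm] using this)
  euler := by
    change numCycles 1 + numCycles (1 * Equiv.boolNot) = numCycles Equiv.boolNot + 2
    rw [one_mul, numCycles_boolNot, numCycles_one, Nat.card_eq_fintype_card, Fintype.card_bool]

/-- A new root edge cuts off the corner between the root `p` and its successor in the root-face. -/
noncomputable def close [Finite D] (M : RootedMap D) (h : M.φ (M.φ M.root) ≠ M.root) :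
    RootedMap (D ⊕ Bool) where
  σ := closeσ M.σ M.root (M.φ (M.φ M.root))
  α := closeα M.α
  root := Sum.inr true
  α_invol := by rintro (x | (_ | _)) <;> simp [M.α_invol]
  α_ne := by rintro (x | (_ | _)) <;> simp [M.α_ne]
  connected u v := conn_iff_exists_mem_closure.1 (conn_iff.2 fun S hσ hα => by
    rw [hσ.iff_inl_retract h.symm u, hσ.iff_inl_retract h.symm v]
    exact conn_iff.1 (M.conn_all _ _) (S ∘ Sum.inl) (hσ.comp_inl_of_closeσ h.symm)
      fun x => hα (Sum.inl x))
  euler := by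
    have hφ : (M.σ * M.α).SameCycle (M.φ (M.φ M.root)) M.root :=
      sameCycle_apply_left.2 (sameCycle_apply_left.2 (SameCycle.refl _ _))
    change numCycles (closeσ _ _ _) + numCycles (closeσ _ _ _ * closeα _) =
      numCycles (closeα _) + 2
    rw [numCycles_closeσ, numCycles_closeα, numCycles_closeσ_mul_closeα _ _ hφ, ← add_assoc, ← φ,
      numCycles_euler, add_right_comm]

section Darts

variable [Finite D] (M : RootedMap D) (h : M.φ (M.φ M.root) ≠ M.root)

@[simp] theorem close_root : (M.close h).root = Sum.inr true := rfl
@[simp] theorem close_α_inl (x : D) : (M.close h).α (Sum.inl x) = Sum.inl (M.α x) := rfl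
@[simp] theorem close_α_true : (M.close h).α (Sum.inr true) = Sum.inr false := rfl
@[simp] theorem close_α_false : (M.close h).α (Sum.inr false) = Sum.inr true := rfl
@[simp] theorem close_σ_true : (M.close h).σ (Sum.inr true) = Sum.inl M.root := closeσ_true M.σ
@[simp] theorem close_σ_false : (M.close h).σ (Sum.inr false) = Sum.inl (M.φ (M.φ M.root)) :=
  closeσ_false M.σ h.symm
@[simp] theorem close_φ_true : (M.close h).φ (Sum.inr true) = Sum.inl (M.φ (M.φ M.root)) :=
  close_σ_false M h
@[simp] theorem close_φ_false : (M.close h).φ (Sum.inr false) = Sum.inl M.root :=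
  close_σ_true M h

theorem close_φ_inl_cases (x : D) :
    (x = M.φ M.root ∧ (M.close h).φ (Sum.inl x) = Sum.inr false) ∨
    (M.φ x = M.root ∧ (M.close h).φ (Sum.inl x) = Sum.inr true) ∨
    (x ≠ M.φ M.root ∧ M.φ x ≠ M.root ∧ (M.close h).φ (Sum.inl x) = Sum.inl (M.φ x)) := by
  have := closeσ_inl_cases M.σ h.symm (M.α x)
  rwa [← M.φ_apply, M.φ.injective.eq_iff, M.φ.injective.ne_iff] at this

theorem close_φ_root (h' : M.φ M.root ≠ M.root) :
    (M.close h).φ (Sum.inl M.root) = Sum.inl (M.φ M.root) := by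
  rcases M.close_φ_inl_cases h M.root with ⟨hr, _⟩ | ⟨hr, _⟩ | ⟨_, _, hr⟩
  · exact absurd hr.symm h'
  · exact absurd hr h'
  · exact hr

theorem close_φ_φ_root : (M.close h).φ (Sum.inl (M.φ M.root)) = Sum.inr false :=
  closeσ_inl_of_eq_right M.σ rfl

theorem sameCycle_close_σ (u v : D ⊕ Bool) : (M.close h).σ.SameCycle u v ↔
    M.σ.SameCycle (retract M.root (M.φ (M.φ M.root)) u) (retract M.root (M.φ (M.φ M.root)) v) :=
  sameCycle_closeσ M.σ h.symm u v

end Darts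

section Iso

variable [Finite D] [Finite D'] {M : RootedMap D} {N : RootedMap D'}

theorem Iso.close (hMN : M.Iso N) (h : M.φ (M.φ M.root) ≠ M.root)
    (h' : N.φ (N.φ N.root) ≠ N.root) : (M.close h).Iso (N.close h') := by
  classical
  obtain ⟨e, hσ, hα, hroot⟩ := hMN
  have hφ := map_φ hσ hα
  refine ⟨Equiv.sumCongr e (Equiv.refl _), fun u => ?_, fun u => ?_, rfl⟩
  · simp only [RootedMap.close, closeσ, Perm.mul_apply]
    rw [(Equiv.injective _).map_swap, (Equiv.injective _).map_swap]
    simp only [Equiv.sumCongr_apply, Sum.map_inl, Sum.map_inr, Equiv.refl_apply, hφ, hroot]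
    rcases u with x | b <;> simp [hσ]
  · rcases u with x | (_ | _) <;> simp [hα]

theorem Iso.of_close {h : M.φ (M.φ M.root) ≠ M.root} {h' : N.φ (N.φ N.root) ≠ N.root}
    (hMN : (M.close h).Iso (N.close h')) : M.Iso N := by
  obtain ⟨e, hσ, hα, htrue⟩ := hMN
  rw [close_root, close_root] at htrue
  have hfalse : e (Sum.inr false) = Sum.inr false := by
    rw [← close_α_true M h, hα, htrue, close_α_true]
  have hr : ∀ b, e (Sum.inr b) = Sum.inr b := Bool.forall_bool.2 ⟨hfalse, htrue⟩
  have hl : ∀ x, ∃ y, e (Sum.inl x) = Sum.inl y := by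
    intro x
    rcases hx : e (Sum.inl x) with y | b
    · exact ⟨y, rfl⟩
    · exact absurd (e.injective (hx.trans (hr b).symm)) Sum.inl_ne_inr
  obtain ⟨f, g, rfl⟩ := exists_eq_equivSumCongr hl fun b => ⟨b, hr b⟩
  have hroot : f M.root = N.root := by simpa [hr] using hσ (Sum.inr true)
  have hthird : f (M.φ (M.φ M.root)) = N.φ (N.φ N.root) := by simpa [hr] using hσ (Sum.inr false)
  have hretract : ∀ u, f (retract M.root (M.φ (M.φ M.root)) u) =
      retract N.root (N.φ (N.φ N.root)) (Equiv.sumCongr f g u) := by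
    rintro (x | (_ | _))
    · rfl
    · rw [hfalse, retract_false, retract_false, hthird]
    · rw [htrue, retract_true, retract_true, hroot]
  refine ⟨f, fun x => ?_, fun x => Sum.inl_injective (hα (Sum.inl x)), hroot⟩
  rw [← retract_closeσ_inl M.σ h.symm, hretract, ← retract_closeσ_inl N.σ h'.symm]
  exact congrArg _ (hσ (Sum.inl x))

end Iso

theorem exists_iso_close_of_eq_closeσ [Finite D] (N : RootedMap (D ⊕ Bool)) {σ α : Perm D} {p w : D}
    (hpw : p ≠ w) (hσ : N.σ = closeσ σ p w) (hα : N.α = closeα α) (hroot : N.root = Sum.inr true)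
    (hw : (σ * α) ((σ * α) p) = w) :
    ∃ (M : RootedMap D) (h : M.φ (M.φ M.root) ≠ M.root), N.Iso (M.close h) := by
  have hface : (σ * α).SameCycle w p := by
    rw [← hw]
    exact sameCycle_apply_left.2 (sameCycle_apply_left.2 (SameCycle.refl _ _))
  have hconn : ∀ x y, conn σ α x y := by
    refine fun x y => conn_iff.2 fun S hS hSα => conn_iff.1 (N.conn_all (Sum.inl x) (Sum.inl y))
      (S ∘ retract p w) (hσ ▸ hS.comp_retract hpw) (hα ▸ ?_)
    have hedge : S w ↔ S p := (hS.mul hSα).iff_of_sameCycle hface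
    rintro (x | (_ | _))
    · exact hSα x
    · exact hedge.symm
    · exact hedge
  let M : RootedMap D :=
    { σ := σ
      α := α
      root := p
      α_invol := fun x => by simpa [hα] using N.α_invol (Sum.inl x)
      α_ne := fun x hx => N.α_ne (Sum.inl x) (by rw [hα, closeα_inl, hx])
      connected := fun x y => conn_iff_exists_mem_closure.1 (hconn x y)
      euler := by
        have := N.numCycles_euler
        rw [φ, hσ, hα, numCycles_closeσ, numCycles_closeα, numCycles_closeσ_mul_closeα σ α hface]
          at this
        change numCycles σ + numCycles (σ * α) = numCycles α + 2
        omega }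
  have hMw : M.φ (M.φ M.root) = w := hw
  refine ⟨M, by rw [hMw]; exact hpw.symm, Equiv.refl _, fun u => ?_, fun u => ?_, hroot⟩
  · simp only [Equiv.refl_apply, close, hMw, hσ]
    rfl
  · simp only [Equiv.refl_apply, close, hα]
    rfl

theorem IsTD.exists_iso_close_of_sum [Finite D] {N : RootedMap (D ⊕ Bool)} (hN : N.IsTD)
    (hroot : N.root = Sum.inr true) (hα : N.α (Sum.inr true) = Sum.inr false)
    (hend : N.σ (Sum.inr false) ≠ Sum.inr false) :
    ∃ (M : RootedMap D) (h : M.φ (M.φ M.root) ≠ M.root), N.Iso (M.close h) := by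
  have hα' : N.α (Sum.inr false) = Sum.inr true := by rw [← hα, N.α_invol]
  have hφtrue : N.φ (Sum.inr true) = N.σ (Sum.inr false) := by rw [φ_apply, hα]
  have hφfalse : N.φ (Sum.inr false) = N.σ (Sum.inr true) := by rw [φ_apply, hα']
  have hface : ¬ N.φ.SameCycle (Sum.inr true) (Sum.inr false) := fun h =>
    hend (hN.eq_of_sameCycle (sameCycle_apply_left.2 (SameCycle.refl _ _))
      (hφtrue ▸ sameCycle_apply_left.2 h))
  obtain ⟨p, hp⟩ : ∃ p, N.σ (Sum.inr true) = Sum.inl p := by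
    rcases h : N.σ (Sum.inr true) with x | (_ | _)
    · exact ⟨x, rfl⟩
    · exact absurd (hφfalse.trans h) (hN.φ_ne _)
    · exact absurd (SameCycle.symm ⟨1, by simpa using hφfalse.trans h⟩) hface
  obtain ⟨w, hw⟩ : ∃ w, N.σ (Sum.inr false) = Sum.inl w := by
    rcases h : N.σ (Sum.inr false) with x | (_ | _)
    · exact ⟨x, rfl⟩
    · exact absurd h hend
    · exact absurd (hφtrue.trans h) (hN.φ_ne _)
  have hpw : p ≠ w := by
    rintro rfl
    simpa using N.σ.injective (hp.trans hw.symm)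
  obtain ⟨α, hNα⟩ := exists_eq_closeα hα hα'
  obtain ⟨σ, hNσ⟩ := exists_eq_closeσ hp hw
  refine N.exists_iso_close_of_eq_closeσ hpw hNσ hNα hroot
    (apply_apply_eq_of_closeσ_triangle σ α hpw ?_)
  rw [← hNσ, ← hNα, ← φ, ← hp, ← hφfalse]
  exact hN.tri _ (hroot ▸ hface)

theorem IsTD.exists_iso_close [Finite D] {M : RootedMap D} (hM : M.IsTD)
    (hend : M.σ (M.α M.root) ≠ M.α M.root) :
    ∃ (D' : Type u) (_ : Finite D') (N : RootedMap D') (h : N.φ (N.φ N.root) ≠ N.root),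
      M.Iso (N.close h) := by
  classical
  let f : {x // x ≠ M.root ∧ x ≠ M.α M.root} ⊕ Bool → D :=
    Sum.elim Subtype.val fun b => if b then M.root else M.α M.root
  have hf : Function.Bijective f := by
    have hne := M.α_ne M.root
    constructor
    · rintro (⟨x, hx, hx'⟩ | (_ | _)) (⟨y, hy, hy'⟩ | (_ | _)) hxy <;>
        simp_all [f, eq_comm]
    · intro x
      by_cases hroot : x = M.root
      · exact ⟨Sum.inr true, by simp [f, hroot]⟩
      by_cases hαroot : x = M.α M.root
      · exact ⟨Sum.inr false, by simp [f, hαroot]⟩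
      · exact ⟨Sum.inl ⟨x, hroot, hαroot⟩, rfl⟩
  let e := (Equiv.ofBijective f hf).symm
  have htrue : e M.root = Sum.inr true := by
    rw [Equiv.symm_apply_eq]
    rfl
  have hfalse : e (M.α M.root) = Sum.inr false := by
    rw [Equiv.symm_apply_eq]
    rfl
  have hα : (M.transport e).α (Sum.inr true) = Sum.inr false := hfalse
  have hσ : (M.transport e).σ (Sum.inr false) = e (M.σ (M.α M.root)) := rfl
  obtain ⟨N, h, hN⟩ := (hM.of_iso (M.iso_transport e)).exists_iso_close_of_sum htrue hα
    (by rw [hσ, ← hfalse]; exact e.injective.ne hend)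
  exact ⟨_, inferInstance, N, h, (M.iso_transport e).trans hN⟩

end Close

end RootedMap

namespace PermCycles

open Equiv (Perm swap swap_apply_left swap_apply_right swap_apply_of_ne_of_ne)
open Equiv.Perm

section Glue

variable {D D' : Type*} (f : Perm D) (g : Perm D') (a : D) (b : D')

open scoped Classical in
/-- The permutation of `D ⊕ D'` obtained from `f` and `g` by merging the cycle of `a` and the cycle
of `b`, with `b` put in the place of `a` and conversely. -/
noncomputable def glue : Perm (D ⊕ D') := swap (Sum.inl a) (Sum.inr b) * sumCongr f g

theorem glue_eq_swap_mul [DecidableEq (D ⊕ D')] :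
    glue f g a b = swap (Sum.inl a) (Sum.inr b) * sumCongr f g := by
  rw [glue]
  congr!

theorem glue_mul (f' : Perm D) (g' : Perm D') :
    glue f g a b * sumCongr f' g' = glue (f * f') (g * g') a b := by
  rw [glue, mul_assoc, sumCongr_mul, glue]

variable {a} in
theorem glue_inl_of_eq {x : D} (hx : f x = a) : glue f g a b (Sum.inl x) = Sum.inr b := by
  classical
  rw [glue_eq_swap_mul, Perm.mul_apply, sumCongr_apply, Sum.map_inl, hx, swap_apply_left]

variable {a} in
theorem glue_inl_of_ne {x : D} (hx : f x ≠ a) : glue f g a b (Sum.inl x) = Sum.inl (f x) := by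
  classical
  rw [glue_eq_swap_mul, Perm.mul_apply, sumCongr_apply, Sum.map_inl,
    swap_apply_of_ne_of_ne (by simpa using hx) (by simp)]

variable {b} in
theorem glue_inr_of_ne {y : D'} (hy : g y ≠ b) : glue f g a b (Sum.inr y) = Sum.inr (g y) := by
  classical
  rw [glue_eq_swap_mul, Perm.mul_apply, sumCongr_apply, Sum.map_inr,
    swap_apply_of_ne_of_ne (by simp) (by simpa using hy)]

section Finite

variable [Finite D] [Finite D']

theorem sameCycle_glue_inl_inl (x y : D) :
    (glue f g a b).SameCycle (Sum.inl x) (Sum.inl y) ↔ f.SameCycle x y := by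
  classical
  rw [glue_eq_swap_mul, sameCycle_swap_mul_iff (not_sameCycle_sumCongr_inl_inr f g)]
  simp only [sameCycle_sumCongr_inl_inl, not_sameCycle_sumCongr_inr_inl, or_false]
  exact ⟨fun h => h.elim id fun h => h.1.symm.trans h.2, Or.inl⟩

theorem sameCycle_glue_inr_inr (x y : D') :
    (glue f g a b).SameCycle (Sum.inr x) (Sum.inr y) ↔ g.SameCycle x y := by
  classical
  rw [glue_eq_swap_mul, sameCycle_swap_mul_iff (not_sameCycle_sumCongr_inl_inr f g)]
  simp only [sameCycle_sumCongr_inr_inr, not_sameCycle_sumCongr_inl_inr, false_or]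
  exact ⟨fun h => h.elim id fun h => h.1.symm.trans h.2, Or.inl⟩

theorem sameCycle_glue_inl_inr (x : D) (y : D') :
    (glue f g a b).SameCycle (Sum.inl x) (Sum.inr y) ↔ f.SameCycle a x ∧ g.SameCycle b y := by
  classical
  rw [glue_eq_swap_mul, sameCycle_swap_mul_iff (not_sameCycle_sumCongr_inl_inr f g)]
  simp only [sameCycle_sumCongr_inr_inr, sameCycle_sumCongr_inl_inl,
    not_sameCycle_sumCongr_inl_inr, not_sameCycle_sumCongr_inr_inl, false_or, or_false]

theorem isInvariant_glue_iff {S : D ⊕ D' → Prop} : IsInvariant (glue f g a b) S ↔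
    (S (Sum.inl a) ↔ S (Sum.inr b)) ∧ IsInvariant f (S ∘ Sum.inl) ∧
      IsInvariant g (S ∘ Sum.inr) := by
  classical
  rw [← isInvariant_sumCongr_iff]
  constructor
  · intro hS
    have hab : S (Sum.inl a) ↔ S (Sum.inr b) := hS.iff_of_sameCycle
      ((sameCycle_glue_inl_inr f g a b a b).2 ⟨SameCycle.refl _ _, SameCycle.refl _ _⟩)
    refine ⟨hab, fun u => ?_⟩
    rw [← hS u, glue_eq_swap_mul, Perm.mul_apply, isInvariant_swap hab]
  · rintro ⟨hab, hS⟩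
    rw [glue_eq_swap_mul]
    exact (isInvariant_swap hab).mul hS

theorem numCycles_glue :
    numCycles f + numCycles g = numCycles (glue f g a b) + 1 := by
  classical
  rw [← numCycles_sumCongr, glue_eq_swap_mul,
    numCycles_swap_mul_of_not_sameCycle (not_sameCycle_sumCongr_inl_inr f g)]

end Finite

end Glue

end PermCycles

namespace RootedMap

open Equiv (Perm swap)
open Equiv.Perm PermCycles

universe u

section Sum

variable {D D' E E' : Type*} {M : RootedMap D} {N : RootedMap D'} {P : RootedMap E}
  {Q : RootedMap E'}

theorem iso_and_iso_of_sumCongr {e : D ⊕ D' ≃ E ⊕ E'}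
    (hσ : ∀ u, e (sumCongr M.σ N.σ u) = sumCongr P.σ Q.σ (e u))
    (hα : ∀ u, e (sumCongr M.α N.α u) = sumCongr P.α Q.α (e u))
    (hM : e (Sum.inl M.root) = Sum.inl P.root) (hN : e (Sum.inr N.root) = Sum.inr Q.root) :
    M.Iso P ∧ N.Iso Q := by
  let isLeft : E ⊕ E' → Prop := fun u => ∃ y, u = Sum.inl y
  have hleft : ∀ (f : Perm E) (g : Perm E'), IsInvariant (sumCongr f g) isLeft := by
    rintro f g (y | y) <;> simp [isLeft]
  obtain ⟨hσM, hσN⟩ := (isInvariant_sumCongr_iff _ _).1 ((isInvariant_map hσ).2 (hleft P.σ Q.σ))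
  obtain ⟨hαM, hαN⟩ := (isInvariant_sumCongr_iff _ _).1 ((isInvariant_map hα).2 (hleft P.α Q.α))
  have hl : ∀ x, ∃ y, e (Sum.inl x) = Sum.inl y := fun x =>
    (conn_iff.1 (M.conn_all M.root x) _ hσM hαM).1 ⟨_, hM⟩
  have hr : ∀ x, ∃ y, e (Sum.inr x) = Sum.inr y := fun x => by
    rcases hx : e (Sum.inr x) with y | y
    · obtain ⟨z, hz⟩ := (conn_iff.1 (N.conn_all x N.root) _ hσN hαN).1 ⟨y, hx⟩
      exact absurd (hN.symm.trans hz) Sum.inr_ne_inl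
    · exact ⟨y, rfl⟩
  obtain ⟨e₁, e₂, rfl⟩ := exists_eq_equivSumCongr hl hr
  exact ⟨⟨e₁, fun x => Sum.inl_injective (hσ (Sum.inl x)),
      fun x => Sum.inl_injective (hα (Sum.inl x)), Sum.inl_injective hM⟩,
    e₂, fun x => Sum.inr_injective (hσ (Sum.inr x)),
      fun x => Sum.inr_injective (hα (Sum.inr x)), Sum.inr_injective hN⟩

end Sum

section Wedge

variable {D D' E E' : Type*} [Finite D] [Finite D']

/-- Two maps glued by identifying the end of the root of the first with the origin of the root
of the second. -/
noncomputable def wedge (M : RootedMap D) (N : RootedMap D') : RootedMap (D ⊕ D') where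
  σ := glue M.σ N.σ (M.φ M.root) N.root
  α := sumCongr M.α N.α
  root := Sum.inl M.root
  α_invol := by rintro (x | x) <;> simp [M.α_invol, N.α_invol]
  α_ne := by rintro (x | x) <;> simp [M.α_ne, N.α_ne]
  connected u v := conn_iff_exists_mem_closure.1 (conn_iff.2 fun S hσ hα => by
    obtain ⟨hroot, hσM, hσN⟩ := (isInvariant_glue_iff _ _ _ _).1 hσ
    obtain ⟨hαM, hαN⟩ := (isInvariant_sumCongr_iff _ _).1 hα
    have hS : ∀ u, S u ↔ S (Sum.inr N.root) := by
      rintro (x | x)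
      · rw [← hroot]
        exact conn_iff.1 (M.conn_all _ _) _ hσM hαM
      · exact conn_iff.1 (N.conn_all _ _) _ hσN hαN
    rw [hS u, hS v])
  euler := by
    have := M.numCycles_euler
    have := N.numCycles_euler
    have := numCycles_glue M.σ N.σ (M.φ M.root) N.root
    have := numCycles_glue M.φ N.φ (M.φ M.root) N.root
    have := numCycles_sumCongr M.α N.α
    change numCycles (glue _ _ _ _) + numCycles (glue _ _ _ _ * sumCongr _ _) =
      numCycles (sumCongr _ _) + 2
    rw [glue_mul, ← φ, ← φ]
    omega

section Darts

variable (M : RootedMap D) (N : RootedMap D')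

theorem wedge_σ [DecidableEq (D ⊕ D')] : (M.wedge N).σ =
    swap (Sum.inl (M.φ M.root)) (Sum.inr N.root) * sumCongr M.σ N.σ :=
  glue_eq_swap_mul _ _ _ _

theorem wedge_φ : (M.wedge N).φ = glue M.φ N.φ (M.φ M.root) N.root :=
  glue_mul _ _ _ _ _ _

@[simp] theorem wedge_root : (M.wedge N).root = Sum.inl M.root := rfl
@[simp] theorem wedge_α_inl (x : D) : (M.wedge N).α (Sum.inl x) = Sum.inl (M.α x) := rfl
@[simp] theorem wedge_α_inr (y : D') : (M.wedge N).α (Sum.inr y) = Sum.inr (N.α y) := rfl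

@[simp] theorem sameCycle_wedge_σ_inl_inl (x y : D) :
    (M.wedge N).σ.SameCycle (Sum.inl x) (Sum.inl y) ↔ M.σ.SameCycle x y :=
  sameCycle_glue_inl_inl _ _ _ _ _ _

@[simp] theorem sameCycle_wedge_σ_inr_inr (x y : D') :
    (M.wedge N).σ.SameCycle (Sum.inr x) (Sum.inr y) ↔ N.σ.SameCycle x y :=
  sameCycle_glue_inr_inr _ _ _ _ _ _

@[simp] theorem sameCycle_wedge_σ_inl_inr (x : D) (y : D') :
    (M.wedge N).σ.SameCycle (Sum.inl x) (Sum.inr y) ↔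
      M.σ.SameCycle (M.φ M.root) x ∧ N.σ.SameCycle N.root y :=
  sameCycle_glue_inl_inr _ _ _ _ _ _

@[simp] theorem sameCycle_wedge_σ_inr_inl (x : D) (y : D') :
    (M.wedge N).σ.SameCycle (Sum.inr y) (Sum.inl x) ↔
      M.σ.SameCycle (M.φ M.root) x ∧ N.σ.SameCycle N.root y :=
  sameCycle_comm.trans (M.sameCycle_wedge_σ_inl_inr N x y)

@[simp] theorem sameCycle_wedge_φ_inl_inl (x y : D) :
    (M.wedge N).φ.SameCycle (Sum.inl x) (Sum.inl y) ↔ M.φ.SameCycle x y := by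
  rw [wedge_φ, sameCycle_glue_inl_inl]

@[simp] theorem sameCycle_wedge_φ_inr_inr (x y : D') :
    (M.wedge N).φ.SameCycle (Sum.inr x) (Sum.inr y) ↔ N.φ.SameCycle x y := by
  rw [wedge_φ, sameCycle_glue_inr_inr]

@[simp] theorem sameCycle_wedge_φ_inl_inr (x : D) (y : D') :
    (M.wedge N).φ.SameCycle (Sum.inl x) (Sum.inr y) ↔
      M.φ.SameCycle M.root x ∧ N.φ.SameCycle N.root y := by
  rw [wedge_φ, sameCycle_glue_inl_inr, sameCycle_apply_left]

theorem wedge_φ_root : (M.wedge N).φ (Sum.inl M.root) = Sum.inr N.root := by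
  rw [wedge_φ, glue_inl_of_eq _ _ _ rfl]

theorem wedge_φ_inl {x : D} (hx : x ≠ M.root) :
    (M.wedge N).φ (Sum.inl x) = Sum.inl (M.φ x) := by
  rw [wedge_φ, glue_inl_of_ne _ _ _ (M.φ.injective.ne hx)]

theorem wedge_φ_inr {x : D'} (hx : N.φ x ≠ N.root) :
    (M.wedge N).φ (Sum.inr x) = Sum.inr (N.φ x) := by
  rw [wedge_φ, glue_inr_of_ne _ _ _ hx]

theorem wedge_σ_inl {x : D} (hx : M.σ x ≠ M.φ M.root) :
    (M.wedge N).σ (Sum.inl x) = Sum.inl (M.σ x) :=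
  glue_inl_of_ne _ _ _ hx

theorem wedge_σ_inl_of_eq {x : D} (hx : M.σ x = M.φ M.root) :
    (M.wedge N).σ (Sum.inl x) = Sum.inr N.root :=
  glue_inl_of_eq _ _ _ hx

theorem wedge_σ_inr {x : D'} (hx : N.σ x ≠ N.root) :
    (M.wedge N).σ (Sum.inr x) = Sum.inr (N.σ x) :=
  glue_inr_of_ne _ _ _ hx

theorem wedge_φ_φ_root (h : N.φ N.root ≠ N.root) :
    (M.wedge N).φ ((M.wedge N).φ (M.wedge N).root) = Sum.inr (N.φ N.root) := by
  rw [wedge_root, wedge_φ_root, wedge_φ_inr _ _ h]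

theorem wedge_φ_φ_root_ne (h : N.φ N.root ≠ N.root) :
    (M.wedge N).φ ((M.wedge N).φ (M.wedge N).root) ≠ (M.wedge N).root := by
  rw [wedge_φ_φ_root M N h]
  exact Sum.inr_ne_inl

end Darts

section Iso

variable [Finite E] [Finite E'] {M : RootedMap D} {N : RootedMap D'} {P : RootedMap E}
  {Q : RootedMap E'}

theorem Iso.wedge (hMP : M.Iso P) (hNQ : N.Iso Q) : (M.wedge N).Iso (P.wedge Q) := by
  classical
  obtain ⟨e, hσ, hα, hroot⟩ := hMP
  obtain ⟨e', hσ', hα', hroot'⟩ := hNQ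
  refine ⟨Equiv.sumCongr e e', fun u => ?_, fun u => ?_, congrArg Sum.inl hroot⟩
  · simp only [wedge_σ, Perm.mul_apply]
    rw [(Equiv.injective _).map_swap]
    simp only [Equiv.sumCongr_apply, Sum.map_inl, Sum.map_inr, map_φ hσ hα, hroot, hroot']
    rcases u with x | x <;> simp [hσ, hσ']
  · rcases u with x | x <;> simp [hα, hα']

theorem Iso.of_wedge (hP : P.IsTD) (hQ : Q.IsTD) (h : (M.wedge N).Iso (P.wedge Q)) :
    M.Iso P ∧ N.Iso Q := by
  classical
  obtain ⟨e, hσ, hα, hrootM⟩ := h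
  have hφ := map_φ hσ hα
  have hrootN : e (Sum.inr N.root) = Sum.inr Q.root := by
    have := hφ (Sum.inl M.root)
    rwa [show e (Sum.inl M.root) = Sum.inl P.root from hrootM, wedge_φ_root, wedge_φ_root] at this
  have hend : e (Sum.inl (M.φ M.root)) = Sum.inl (P.φ P.root) := by
    have hvertex : (M.wedge N).σ.SameCycle (Sum.inl (M.φ M.root)) (Sum.inr N.root) := by
      simp [SameCycle.refl]
    have hface : (M.wedge N).φ.SameCycle (Sum.inl (M.φ M.root)) (Sum.inr N.root) := by
      simp [SameCycle.refl]
    rw [sameCycle_map e hσ, hrootN] at hvertex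
    rw [sameCycle_map e hφ, hrootN] at hface
    rcases hy : e (Sum.inl (M.φ M.root)) with y | y
    · rw [hy, sameCycle_wedge_σ_inl_inr] at hvertex
      rw [hy, sameCycle_wedge_φ_inl_inr] at hface
      rw [hP.eq_of_sameCycle hvertex.1 (sameCycle_apply_left.2 hface.1)]
    · rw [hy, sameCycle_wedge_σ_inr_inr] at hvertex
      rw [hy, sameCycle_wedge_φ_inr_inr] at hface
      rw [hQ.eq_of_sameCycle hvertex hface, ← hrootN] at hy
      exact absurd (e.injective hy) Sum.inl_ne_inr
  refine iso_and_iso_of_sumCongr (e := e) (fun u => ?_) hα hrootM hrootN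
  have hM : sumCongr M.σ N.σ u =
      swap (Sum.inl (M.φ M.root)) (Sum.inr N.root) ((M.wedge N).σ u) := by
    rw [wedge_σ, ← Perm.mul_apply, Equiv.swap_mul_self_mul]
  have hP : sumCongr P.σ Q.σ (e u) =
      swap (Sum.inl (P.φ P.root)) (Sum.inr Q.root) ((P.wedge Q).σ (e u)) := by
    rw [wedge_σ, ← Perm.mul_apply, Equiv.swap_mul_self_mul]
  rw [hM, e.injective.map_swap, hend, hrootN, hσ, hP]

end Iso

end Wedge

end RootedMap

namespace PermCycles

open Equiv (Perm)
open Equiv.Perm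

theorem numCycles_add_numCycles_mul_le {D : Type*} [Finite D] [Nonempty D] {σ α : Perm D}
    (hinvol : ∀ x, α (α x) = x) (hne : ∀ x, α x ≠ x) (hconn : ∀ x y, conn σ α x y) :
    numCycles σ + numCycles (σ * α) ≤ numCycles α + 2 := by
  have hgenus := numCycles_add_numCycles_add_numCycles_mul_le σ α
  rw [card_quotient_conn_eq_one hconn, numCycles_mul_comm α,
    ← two_mul_numCycles_of_involutive hinvol hne] at hgenus
  omega

end PermCycles

namespace RootedMap

open Equiv (Perm swap)
open Equiv.Perm PermCycles

universe u

section ExistsWedge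

variable {D D' : Type*} [Finite D] [Finite D']

theorem conn_of_σ_eq_glue (N : RootedMap (D ⊕ D')) {σ₁ α₁ : Perm D} {σ₂ α₂ : Perm D'} {a : D}
    {b : D'} (hσ : N.σ = glue σ₁ σ₂ a b) (hα : N.α = sumCongr α₁ α₂) :
    (∀ x y, conn σ₁ α₁ x y) ∧ ∀ x y, conn σ₂ α₂ x y := by
  constructor <;> refine fun x y => conn_iff.2 fun S hS hSα => ?_
  · refine conn_iff.1 (N.conn_all (Sum.inl x) (Sum.inl y)) (Sum.elim S fun _ => S a) ?_ ?_
    · rw [hσ, isInvariant_glue_iff]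
      exact ⟨Iff.rfl, hS, fun _ => Iff.rfl⟩
    · rw [hα, isInvariant_sumCongr_iff]
      exact ⟨hSα, fun _ => Iff.rfl⟩
  · refine conn_iff.1 (N.conn_all (Sum.inr x) (Sum.inr y)) (Sum.elim (fun _ => S b) S) ?_ ?_
    · rw [hσ, isInvariant_glue_iff]
      exact ⟨Iff.rfl, fun _ => Iff.rfl, hS⟩
    · rw [hα, isInvariant_sumCongr_iff]
      exact ⟨fun _ => Iff.rfl, hSα⟩

theorem exists_iso_wedge_of_σ_eq_glue (N : RootedMap (D ⊕ D')) {σ₁ α₁ : Perm D} {σ₂ α₂ : Perm D'}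
    {p : D} {q : D'} (hσ : N.σ = glue σ₁ σ₂ (σ₁ (α₁ p)) q) (hα : N.α = sumCongr α₁ α₂)
    (hroot : N.root = Sum.inl p) :
    ∃ (M₁ : RootedMap D) (M₂ : RootedMap D'), N.Iso (M₁.wedge M₂) := by
  have hφ : N.φ = glue (σ₁ * α₁) (σ₂ * α₂) (σ₁ (α₁ p)) q := by rw [φ, hσ, hα, glue_mul]
  obtain ⟨hconn₁, hconn₂⟩ := N.conn_of_σ_eq_glue hσ hα
  have hinvol₁ : ∀ x, α₁ (α₁ x) = x := fun x => by simpa [hα] using N.α_invol (Sum.inl x)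
  have hinvol₂ : ∀ x, α₂ (α₂ x) = x := fun x => by simpa [hα] using N.α_invol (Sum.inr x)
  have hne₁ : ∀ x, α₁ x ≠ x := fun x => by simpa [hα] using N.α_ne (Sum.inl x)
  have hne₂ : ∀ x, α₂ x ≠ x := fun x => by simpa [hα] using N.α_ne (Sum.inr x)
  have : Nonempty D := ⟨p⟩
  have : Nonempty D' := ⟨q⟩
  have heuler : numCycles σ₁ + numCycles (σ₁ * α₁) = numCycles α₁ + 2 ∧
      numCycles σ₂ + numCycles (σ₂ * α₂) = numCycles α₂ + 2 := by
    have hgenus₁ := numCycles_add_numCycles_mul_le hinvol₁ hne₁ hconn₁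
    have hgenus₂ := numCycles_add_numCycles_mul_le hinvol₂ hne₂ hconn₂
    have hvertices := numCycles_glue σ₁ σ₂ (σ₁ (α₁ p)) q
    have hfaces := numCycles_glue (σ₁ * α₁) (σ₂ * α₂) (σ₁ (α₁ p)) q
    have hedges := numCycles_sumCongr α₁ α₂
    have hN := N.numCycles_euler
    rw [hσ, hφ, hα] at hN
    omega
  exact ⟨⟨σ₁, α₁, p, hinvol₁, hne₁, fun x y => conn_iff_exists_mem_closure.1 (hconn₁ x y),
      heuler.1⟩,
    ⟨σ₂, α₂, q, hinvol₂, hne₂, fun x y => conn_iff_exists_mem_closure.1 (hconn₂ x y), heuler.2⟩,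
    Equiv.refl _, Equiv.congr_fun hσ, Equiv.congr_fun hα, hroot⟩

theorem exists_iso_wedge {D : Type u} [Finite D] (M : RootedMap D) {s : D} (hs : s ≠ M.φ M.root)
    (hσ : M.σ.SameCycle s (M.φ M.root)) (hφ : M.φ.SameCycle s (M.φ M.root)) :
    ∃ (D₁ D₂ : Type u) (_ : Finite D₁) (_ : Finite D₂) (M₁ : RootedMap D₁) (M₂ : RootedMap D₂),
      M.Iso (M₁.wedge M₂) := by
  classical
  let g := swap s (M.φ M.root) * M.σ
  let P : D → Prop := conn g M.α s
  have hPs : P s := (conn g M.α).refl s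
  have hPend : ¬ P (M.φ M.root) := M.not_conn_swap_mul hs hσ hφ
  have hPg : IsInvariant g P := isInvariant_left_conn g M.α s
  have hPα : IsInvariant M.α P := isInvariant_right_conn g M.α s
  have hg : g (M.α M.root) = s := by simp [g, ← M.φ_apply]
  have hProot : P M.root := (hPα _).1 ((hPg _).1 (hg.symm ▸ hPs))
  let e : D ≃ {x // P x} ⊕ {x // ¬ P x} := (Equiv.sumCompl P).symm
  have heEnd : e (M.φ M.root) = Sum.inr ⟨_, hPend⟩ :=
    Equiv.sumCompl_symm_apply_of_neg hPend
  have hsplit : ∀ f : Perm D, IsInvariant f P → ∃ f₁ f₂, e.permCongr f = sumCongr f₁ f₂ :=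
    fun f hf => exists_eq_sumCongr_of_forall_inl fun y =>
      ⟨⟨f y.1, (hf _).2 y.2⟩, Equiv.sumCompl_symm_apply_of_pos ((hf _).2 y.2)⟩
  obtain ⟨σ₁, σ₂, hσ₁₂⟩ := hsplit g hPg
  obtain ⟨α₁, α₂, hα₁₂⟩ := hsplit M.α hPα
  have heRoot : e M.root = Sum.inl ⟨_, hProot⟩ := Equiv.sumCompl_symm_apply_of_pos hProot
  have hes : e s = Sum.inl (σ₁ (α₁ ⟨_, hProot⟩)) := by
    rw [← Sum.map_inl (f := σ₁) (g := σ₂), ← Sum.map_inl (f := α₁) (g := α₂), ← heRoot,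
      ← sumCongr_apply, ← sumCongr_apply, ← hσ₁₂, ← hα₁₂]
    simp [hg]
  have hσe : (M.transport e).σ = glue σ₁ σ₂ (σ₁ (α₁ ⟨_, hProot⟩)) ⟨_, hPend⟩ := by
    have hswap : M.σ = swap s (M.φ M.root) * g := (Equiv.swap_mul_self_mul _ _ _).symm
    rw [glue_eq_swap_mul, ← hσ₁₂, ← hes, ← heEnd, ← Equiv.symm_trans_swap_trans]
    ext x
    simp [transport, hswap, -Equiv.symm_trans_swap_trans]
  obtain ⟨M₁, M₂, hiso⟩ :=
    (M.transport e).exists_iso_wedge_of_σ_eq_glue hσe hα₁₂ heRoot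
  exact ⟨_, _, inferInstance, inferInstance, M₁, M₂, (M.iso_transport e).trans hiso⟩

end ExistsWedge

end RootedMap

namespace PermCycles

open Equiv (Perm)
open Equiv.Perm

section Embedding

variable {D D' : Type*} {f : Perm D} {g : Perm D'} {ι : D → D'} {x : D}

theorem apply_apply_apply_eq_iff_of_injective (hι : Function.Injective ι)
    (h : ∀ y, f.SameCycle x y → g (ι y) = ι (f y)) :
    g (g (g (ι x))) = ι x ↔ f (f (f x)) = x := by
  rw [h x (SameCycle.refl _ _), h (f x) (by simp [SameCycle.refl]),
    h (f (f x)) (by simp [SameCycle.refl]), hι.eq_iff]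

theorem apply_ne_and_apply_apply_ne_iff_of_injective (hι : Function.Injective ι)
    (h : ∀ y, f.SameCycle x y → g (ι y) = ι (f y)) :
    (g (ι x) ≠ ι x ∧ g (g (ι x)) ≠ ι x) ↔ (f x ≠ x ∧ f (f x) ≠ x) := by
  rw [h x (SameCycle.refl _ _), h (f x) (by simp [SameCycle.refl]), hι.ne_iff, hι.ne_iff]

end Embedding

end PermCycles

namespace RootedMap

open Equiv (Perm)
open Equiv.Perm PermCycles

section CloseClass

variable {D : Type*}

/-- The end of the root has degree at least three: on the darts of a vertex of degree one or two,
`σ` is an involution. -/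
def ThreeLeEndDegree (M : RootedMap D) : Prop := M.σ (M.σ (M.φ M.root)) ≠ M.φ M.root

theorem not_sameCycle_φ {M : RootedMap D} (hM : ∀ d, ¬ M.σ.SameCycle d (M.α d)) (d : D) :
    ¬ M.σ.SameCycle d (M.φ d) := by
  rw [φ_apply, sameCycle_apply_right]
  exact hM d

variable [Finite D]

section

variable (M : RootedMap D) (h : M.φ (M.φ M.root) ≠ M.root)

theorem close_φ_inl_of_not_sameCycle {x : D} (hx : ¬ M.φ.SameCycle M.root x) :
    (M.close h).φ (Sum.inl x) = Sum.inl (M.φ x) := by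
  rcases M.close_φ_inl_cases h x with ⟨rfl, _⟩ | ⟨hroot, _⟩ | ⟨_, _, hφ⟩
  · exact absurd (sameCycle_apply_right.2 (SameCycle.refl _ _)) hx
  · exact absurd (by rw [← sameCycle_apply_right, hroot]) hx
  · exact hφ

theorem close_deg_iff {x : D} (hroot : ¬ M.σ.SameCycle x M.root)
    (hφ : ¬ M.σ.SameCycle x (M.φ (M.φ M.root))) :
    ((M.close h).σ (Sum.inl x) ≠ Sum.inl x ∧
      (M.close h).σ ((M.close h).σ (Sum.inl x)) ≠ Sum.inl x) ↔
    (M.σ x ≠ x ∧ M.σ (M.σ x) ≠ x) := by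
  refine apply_ne_and_apply_apply_ne_iff_of_injective Sum.inl_injective fun y hy =>
    closeσ_inl_of_ne M.σ (fun hy' => hφ ?_) fun hy' => hroot ?_ <;>
  rwa [← hy', sameCycle_apply_right]

theorem sameCycle_close_φ_of_sameCycle {x : D} (hx : M.φ.SameCycle M.root x) :
    x = M.root ∨ x = M.φ M.root ∨ (M.close h).φ.SameCycle (Sum.inr true) (Sum.inl x) := by
  have hthird : (M.close h).φ.SameCycle (Sum.inr true) (Sum.inl (M.φ (M.φ M.root))) := by
    rw [← close_φ_true M h, sameCycle_apply_right]
  refine sameCycle_induction (S := fun x => x = M.root ∨ x = M.φ M.root ∨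
    (M.close h).φ.SameCycle (Sum.inr true) (Sum.inl x)) ?_ hx (Or.inl rfl)
  rintro x (rfl | rfl | hx)
  · exact Or.inr (Or.inl rfl)
  · exact Or.inr (Or.inr hthird)
  · rcases M.close_φ_inl_cases h x with ⟨rfl, _⟩ | ⟨hroot, _⟩ | ⟨_, _, hφ⟩
    · exact Or.inr (Or.inr hthird)
    · exact Or.inl hroot
    · exact Or.inr (Or.inr (by rwa [← hφ, sameCycle_apply_right]))

theorem close_rootFace_iff (h' : M.φ M.root ≠ M.root) (u : D ⊕ Bool) :
    (M.close h).φ.SameCycle (Sum.inr true) u ↔ u = Sum.inr true ∨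
      ∃ x, u = Sum.inl x ∧ M.φ.SameCycle M.root x ∧ x ≠ M.root ∧ x ≠ M.φ M.root := by
  constructor
  · intro hu
    refine sameCycle_induction (S := fun u => u = Sum.inr true ∨
      ∃ x, u = Sum.inl x ∧ M.φ.SameCycle M.root x ∧ x ≠ M.root ∧ x ≠ M.φ M.root) ?_ hu (Or.inl rfl)
    rintro _ (rfl | ⟨x, rfl, hx, hxr, hxφ⟩)
    · rw [close_φ_true]
      exact Or.inr ⟨_, rfl, by simp [SameCycle.refl], h, M.φ.injective.ne h'⟩
    · rcases M.close_φ_inl_cases h x with ⟨hx', _⟩ | ⟨_, hφ⟩ | ⟨_, hφx, hφ⟩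
      · exact absurd hx' hxφ
      · exact Or.inl hφ
      · exact Or.inr ⟨_, hφ, by simpa using hx, hφx, M.φ.injective.ne hxr⟩
  · rintro (rfl | ⟨x, rfl, hx, hxr, hxφ⟩)
    · exact SameCycle.refl _ _
    · exact ((M.sameCycle_close_φ_of_sameCycle h hx).resolve_left hxr).resolve_left hxφ

theorem close_internalTriangles_iff (h' : M.φ M.root ≠ M.root) :
    (M.close h).InternalTriangles ↔ M.InternalTriangles := by
  have triangle_iff : ∀ x, ¬ M.φ.SameCycle M.root x →
      ((M.close h).φ ((M.close h).φ ((M.close h).φ (Sum.inl x))) = Sum.inl x ↔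
        M.φ (M.φ (M.φ x)) = x) := fun x hx =>
    apply_apply_apply_eq_iff_of_injective Sum.inl_injective fun y hy =>
      M.close_φ_inl_of_not_sameCycle h fun hy' => hx (hy'.trans hy.symm)
  have hφ := M.close_φ_root h h'
  have hφφ := M.close_φ_φ_root h
  constructor
  · intro hT x hx
    refine (triangle_iff x hx).1 (hT _ ?_)
    rw [close_root, M.close_rootFace_iff h h']
    rintro (hu | ⟨y, hu, hy, _⟩)
    · cases hu
    · exact hx (Sum.inl.inj hu ▸ hy)
  · intro hT u hu
    rw [close_root, M.close_rootFace_iff h h'] at hu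
    rcases u with x | (_ | _)
    · by_cases hx : M.φ.SameCycle M.root x
      · by_cases hxr : x = M.root
        · rw [hxr, hφ, hφφ, close_φ_false]
        · by_cases hxφ : x = M.φ M.root
          · rw [hxφ, hφφ, close_φ_false, hφ]
          · exact absurd (Or.inr ⟨x, rfl, hx, hxr, hxφ⟩) hu
      · exact (triangle_iff x hx).2 (hT x hx)
    · rw [close_φ_false, hφ, hφφ]
    · exact absurd (Or.inl rfl) hu

theorem exists_inl_of_close_internal (h' : M.φ M.root ≠ M.root) {d : D ⊕ Bool}
    (hd : ∀ y, (M.close h).φ.SameCycle (Sum.inr true) y → ¬ (M.close h).σ.SameCycle d y) :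
    ∃ x, d = Sum.inl x ∧ ¬ M.σ.SameCycle x M.root ∧ ¬ M.σ.SameCycle x (M.φ (M.φ M.root)) ∧
      ∀ y, M.φ.SameCycle M.root y → y ≠ M.φ M.root → ¬ M.σ.SameCycle x y := by
  have hroot := hd _ (SameCycle.refl _ _)
  have hthird := hd (Sum.inl (M.φ (M.φ M.root))) (by rw [← close_φ_true M h, sameCycle_apply_right])
  rw [sameCycle_close_σ] at hroot hthird
  rcases d with x | (_ | _)
  · refine ⟨x, rfl, hroot, hthird, fun y hy hy' hxy => ?_⟩
    by_cases hyr : y = M.root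
    · exact hroot (hyr ▸ hxy)
    · refine hd (Sum.inl y) ((M.close_rootFace_iff h h' _).2 (Or.inr ⟨y, rfl, hy, hyr, hy'⟩)) ?_
      rwa [sameCycle_close_σ]
  · exact absurd (SameCycle.refl _ _) hthird
  · exact absurd (SameCycle.refl _ _) hroot

end

variable {M : RootedMap D} {h : M.φ (M.φ M.root) ≠ M.root}

theorem IsUnionOff.of_close {c : D ⊕ Bool} {S : D ⊕ Bool → Prop}
    (hS : (M.close h).IsUnionOff c S) :
    M.IsUnionOff (retract M.root (M.φ (M.φ M.root)) c) (S ∘ Sum.inl) where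
  σ := hS.σ.comp_inl_of_closeσ h.symm
  α x hx hαx := hS.α (Sum.inl x) (by rwa [sameCycle_close_σ]) (by rwa [sameCycle_close_σ])

theorem IsUnionOff.close {c : D} {S : D → Prop} (hS : M.IsUnionOff c S)
    (hnew : ¬ M.σ.SameCycle c M.root → ¬ M.σ.SameCycle c (M.φ (M.φ M.root)) →
      (S (M.φ (M.φ M.root)) ↔ S M.root)) :
    (M.close h).IsUnionOff (Sum.inl c) (S ∘ retract M.root (M.φ (M.φ M.root))) where
  σ := hS.σ.comp_retract h.symm
  α u hu hαu := by
    rw [sameCycle_close_σ] at hu hαu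
    rcases u with x | (_ | _)
    · exact hS.α x hu hαu
    · exact (hnew hαu hu).symm
    · exact hnew hu hαu

theorem IsTD.close (hM : M.IsTD) (h : M.φ (M.φ M.root) ≠ M.root)
    (hdeg : M.ThreeLeEndDegree) : (M.close h).IsTD := by
  have h' := hM.φ_ne M.root
  have hpw : ¬ M.σ.SameCycle M.root (M.φ (M.φ M.root)) := fun hσ =>
    h (hM.eq_of_sameCycle hσ (by simp [SameCycle.refl])).symm
  refine ⟨?_, fun hS _ _ ha hb => ?_, (M.close_internalTriangles_iff h h').2 hM.tri, fun d hd => ?_⟩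
  · rintro (x | (_ | _)) <;> rw [sameCycle_close_σ]
    · exact hM.loopless x
    · exact fun hσ => hpw hσ.symm
    · exact hpw
  · rw [sameCycle_close_σ] at ha hb
    exact (hS.σ.iff_inl_retract h.symm _).trans
      ((hM.nonsep hS.of_close ha hb).trans (hS.σ.iff_inl_retract h.symm _).symm)
  · obtain ⟨x, rfl, hroot, hthird, hface⟩ := M.exists_inl_of_close_internal h h' hd
    rw [close_deg_iff M h hroot hthird]
    by_cases hend : M.σ.SameCycle x (M.φ M.root)
    · have hσσ : M.σ (M.σ x) ≠ x := fun hx =>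
        hdeg (((show IsInvariant M.σ fun z => M.σ (M.σ z) = z from
          fun z => M.σ.injective.eq_iff).iff_of_sameCycle hend).1 hx)
      exact ⟨fun hx => hσσ (by rw [hx, hx]), hσσ⟩
    · refine hM.deg x fun y hy => ?_
      by_cases hyend : y = M.φ M.root
      · rwa [hyend]
      · exact hface y hy hyend

/-- Off the end of the root, walk along the triangle; off another vertex, which is not on the outer
face, walk around that face. -/
theorem IsUnionOff.iff_of_close_internal (hloop : ∀ d, ¬ M.σ.SameCycle d (M.α d))
    (hint : ∀ y, (M.close h).φ.SameCycle (Sum.inr true) y →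
      ¬ (M.close h).σ.SameCycle (Sum.inl (M.φ M.root)) y) {c : D} {S : D → Prop}
    (hS : M.IsUnionOff c S) (hroot : ¬ M.σ.SameCycle c M.root)
    (hthird : ¬ M.σ.SameCycle c (M.φ (M.φ M.root))) :
    S (M.φ (M.φ M.root)) ↔ S M.root := by
  have h' : M.φ M.root ≠ M.root := fun hr => not_sameCycle_φ hloop M.root (by rw [hr])
  have hφ : ∀ x, ¬ M.σ.SameCycle c x → ¬ M.σ.SameCycle c (M.φ x) → (S (M.φ x) ↔ S x) := by
    intro x hx hφx
    rw [φ_apply, hS.σ]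
    exact hS.α x hx (by rwa [φ_apply, sameCycle_apply_right] at hφx)
  by_cases hend : M.σ.SameCycle c (M.φ M.root)
  · have hface : ∀ u, (M.close h).φ.SameCycle (Sum.inr true) u →
        ¬ M.σ.SameCycle c (retract M.root (M.φ (M.φ M.root)) u) := by
      intro u hu hcu
      apply hint u hu
      rw [sameCycle_close_σ]
      exact hend.symm.trans hcu
    have haround := apply_iff_of_forall_ne (f := (M.close h).φ) (r := Sum.inr true)
      (S := S ∘ retract M.root (M.φ (M.φ M.root))) fun u hu hur => ?_
    · rwa [close_φ_true] at haround
    · obtain ⟨x, rfl, _⟩ := ((M.close_rootFace_iff h h' u).1 hu).resolve_left hur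
      have hx' := hface _ (sameCycle_apply_right.2 hu)
      have hretract : retract M.root (M.φ (M.φ M.root)) ((M.close h).φ (Sum.inl x)) = M.φ x :=
        retract_closeσ_inl M.σ h.symm (M.α x)
      rw [Function.comp_apply, hretract]
      exact hφ x (hface _ hu) (hretract ▸ hx')
  · rw [hφ _ hend hthird, hφ _ hroot hend]

theorem IsTD.of_close (hC : (M.close h).IsTD)
    (hint : ∀ y, (M.close h).φ.SameCycle (Sum.inr true) y →
      ¬ (M.close h).σ.SameCycle (Sum.inl (M.φ M.root)) y) :
    M.IsTD ∧ M.ThreeLeEndDegree := by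
  have hloop : ∀ d, ¬ M.σ.SameCycle d (M.α d) := fun d => by
    simpa only [sameCycle_close_σ, close_α_inl, retract_inl] using hC.loopless (Sum.inl d)
  have hloop' := not_sameCycle_φ hloop
  have h' : M.φ M.root ≠ M.root := fun hr => hloop' M.root (by rw [hr])
  have hend := hC.deg _ hint
  rw [close_deg_iff M h (fun hr => hloop' _ hr.symm) (hloop' _)] at hend
  refine ⟨⟨hloop, fun {c S} hS a b ha hb => ?_, (M.close_internalTriangles_iff h h').1 hC.tri,
    fun d hd => ?_⟩, hend.2⟩
  · exact hC.nonsep (hS.close (hS.iff_of_close_internal hloop hint)) (a := Sum.inl a)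
      (b := Sum.inl b) (by rwa [sameCycle_close_σ]) (by rwa [sameCycle_close_σ])
  · rw [← close_deg_iff M h (hd _ (SameCycle.refl _ _)) (hd _ (by simp [SameCycle.refl]))]
    refine hC.deg _ fun u hu => ?_
    rw [sameCycle_close_σ]
    rcases (M.close_rootFace_iff h h' u).1 hu with rfl | ⟨x, rfl, hx, _⟩
    · exact hd _ (SameCycle.refl _ _)
    · exact hd _ hx

end CloseClass

end RootedMap

namespace RootedMap

open Equiv (Perm)
open Equiv.Perm PermCycles

section WedgeClass

variable {D D' : Type*} [Finite D] [Finite D'] {M : RootedMap D} {N : RootedMap D'}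

theorem wedge_internalTriangles_iff :
    (M.wedge N).InternalTriangles ↔ M.InternalTriangles ∧ N.InternalTriangles := by
  have triangle_iff_inl : ∀ x, ¬ M.φ.SameCycle M.root x → ((M.wedge N).φ ((M.wedge N).φ
      ((M.wedge N).φ (Sum.inl x))) = Sum.inl x ↔ M.φ (M.φ (M.φ x)) = x) := fun x hx =>
    apply_apply_apply_eq_iff_of_injective Sum.inl_injective fun y hy =>
      wedge_φ_inl M N fun hy' => hx (hy' ▸ hy.symm)
  have triangle_iff_inr : ∀ x, ¬ N.φ.SameCycle N.root x → ((M.wedge N).φ ((M.wedge N).φ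
      ((M.wedge N).φ (Sum.inr x))) = Sum.inr x ↔ N.φ (N.φ (N.φ x)) = x) := fun x hx =>
    apply_apply_apply_eq_iff_of_injective Sum.inr_injective fun y hy =>
      wedge_φ_inr M N fun hy' => hx (by rw [← hy', sameCycle_apply_left]; exact hy.symm)
  constructor
  · refine fun h => ⟨fun x hx => (triangle_iff_inl x hx).1 (h _ ?_),
      fun x hx => (triangle_iff_inr x hx).1 (h _ ?_)⟩
    · simpa using hx
    · simp [hx]
  · rintro ⟨hM, hN⟩ (x | x) hx
    · rw [wedge_root, sameCycle_wedge_φ_inl_inl] at hx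
      exact (triangle_iff_inl x hx).2 (hM x hx)
    · rw [wedge_root, sameCycle_wedge_φ_inl_inr] at hx
      have hx' : ¬ N.φ.SameCycle N.root x := fun h => hx ⟨SameCycle.refl _ _, h⟩
      exact (triangle_iff_inr x hx').2 (hN x hx')

theorem wedge_deg_inl_iff {x : D} (hx : ¬ M.σ.SameCycle x (M.φ M.root)) :
    ((M.wedge N).σ (Sum.inl x) ≠ Sum.inl x ∧
      (M.wedge N).σ ((M.wedge N).σ (Sum.inl x)) ≠ Sum.inl x) ↔ (M.σ x ≠ x ∧ M.σ (M.σ x) ≠ x) :=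
  apply_ne_and_apply_apply_ne_iff_of_injective Sum.inl_injective fun y hy =>
    wedge_σ_inl M N fun hy' => hx (by rwa [← hy', sameCycle_apply_right])

theorem wedge_deg_inr_iff {x : D'} (hx : ¬ N.σ.SameCycle x N.root) :
    ((M.wedge N).σ (Sum.inr x) ≠ Sum.inr x ∧
      (M.wedge N).σ ((M.wedge N).σ (Sum.inr x)) ≠ Sum.inr x) ↔ (N.σ x ≠ x ∧ N.σ (N.σ x) ≠ x) :=
  apply_ne_and_apply_apply_ne_iff_of_injective Sum.inr_injective fun y hy =>
    wedge_σ_inr M N fun hy' => hx (by rwa [← hy', sameCycle_apply_right])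

theorem wedge_not_isTD : ¬ (M.wedge N).IsTD := fun h =>
  Sum.inl_ne_inr (h.eq_of_sameCycle (a := Sum.inl (M.φ M.root)) (b := Sum.inr N.root)
    (by simp [SameCycle.refl]) (by simp [SameCycle.refl]))

theorem IsUnionOff.inl_of_wedge {c : D} {S : D ⊕ D' → Prop}
    (hS : (M.wedge N).IsUnionOff (Sum.inl c) S) : M.IsUnionOff c (S ∘ Sum.inl) where
  σ := ((isInvariant_glue_iff _ _ _ _).1 hS.σ).2.1
  α x hx hαx := hS.α (Sum.inl x) (by simpa using hx) (by simpa using hαx)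

theorem IsUnionOff.inr_of_wedge {c : D'} {S : D ⊕ D' → Prop}
    (hS : (M.wedge N).IsUnionOff (Sum.inr c) S) : N.IsUnionOff c (S ∘ Sum.inr) where
  σ := ((isInvariant_glue_iff _ _ _ _).1 hS.σ).2.2
  α x hx hαx := hS.α (Sum.inr x) (by simpa using hx) (by simpa using hαx)

theorem IsUnionOff.iff_of_wedge_inl (hM : M.IsTD) {c : D} {S : D ⊕ D' → Prop}
    (hS : (M.wedge N).IsUnionOff (Sum.inl c) S) (hc : ¬ M.σ.SameCycle c (M.φ M.root))
    {u : D ⊕ D'} (hu : ¬ (M.wedge N).σ.SameCycle (Sum.inl c) u) : S u ↔ S (Sum.inr N.root) := by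
  obtain ⟨hroot, -, hσN⟩ := (isInvariant_glue_iff _ _ _ _).1 hS.σ
  have hc' : ¬ M.σ.SameCycle (M.φ M.root) c := fun h => hc h.symm
  rcases u with x | x
  · rw [← hroot]
    exact hM.nonsep hS.inl_of_wedge (by simpa using hu) hc
  · exact conn_iff.1 (N.conn_all x N.root) _ hσN fun y =>
      hS.α (Sum.inr y) (by simp [hc']) (by simp [hc'])

theorem IsUnionOff.iff_of_wedge_inr (hN : N.IsTD) {c : D'} {S : D ⊕ D' → Prop}
    (hS : (M.wedge N).IsUnionOff (Sum.inr c) S) (hc : ¬ N.σ.SameCycle c N.root)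
    {u : D ⊕ D'} (hu : ¬ (M.wedge N).σ.SameCycle (Sum.inr c) u) : S u ↔ S (Sum.inr N.root) := by
  obtain ⟨hroot, hσM, -⟩ := (isInvariant_glue_iff _ _ _ _).1 hS.σ
  have hc' : ¬ N.σ.SameCycle N.root c := fun h => hc h.symm
  rcases u with x | x
  · rw [← hroot]
    exact conn_iff.1 (M.conn_all x (M.φ M.root)) _ hσM fun y =>
      hS.α (Sum.inl y) (by simp [hc']) (by simp [hc'])
  · exact hN.nonsep hS.inr_of_wedge (by simpa using hu) hc

theorem IsUnionOff.iff_of_wedge_join (hM : M.IsTD) (hN : N.IsTD) {S : D ⊕ D' → Prop}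
    (hS : (M.wedge N).IsUnionOff (Sum.inr N.root) S)
    (hnew : S (Sum.inr (N.φ N.root)) ↔ S (Sum.inl M.root)) {u : D ⊕ D'}
    (hu : ¬ (M.wedge N).σ.SameCycle (Sum.inr N.root) u) : S u ↔ S (Sum.inl M.root) := by
  rcases u with x | x
  · have hS' : (M.wedge N).IsUnionOff (Sum.inl (M.φ M.root)) S :=
      hS.of_sameCycle (by simp [SameCycle.refl])
    exact hM.nonsep hS'.inl_of_wedge (by simpa [SameCycle.refl] using hu)
      fun h => not_sameCycle_φ hM.loopless _ h.symm
  · rw [← hnew]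
    exact hN.nonsep hS.inr_of_wedge (by simpa using hu) (not_sameCycle_φ hN.loopless _)

theorem IsUnionOff.iff_of_wedge (hM : M.IsTD) (hN : N.IsTD) {c : D ⊕ D'} {S : D ⊕ D' → Prop}
    (hS : (M.wedge N).IsUnionOff c S)
    (hnew : ¬ (M.wedge N).σ.SameCycle c (Sum.inl M.root) →
      ¬ (M.wedge N).σ.SameCycle c (Sum.inr (N.φ N.root)) →
      (S (Sum.inr (N.φ N.root)) ↔ S (Sum.inl M.root)))
    {a b : D ⊕ D'} (ha : ¬ (M.wedge N).σ.SameCycle c a) (hb : ¬ (M.wedge N).σ.SameCycle c b) :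
    S a ↔ S b := by
  have hloopM : ¬ M.σ.SameCycle (M.φ M.root) M.root := fun h =>
    not_sameCycle_φ hM.loopless _ h.symm
  have hloopN := not_sameCycle_φ hN.loopless N.root
  by_cases hc : (M.wedge N).σ.SameCycle (Sum.inr N.root) c
  · have hoff : ∀ {u}, ¬ (M.wedge N).σ.SameCycle c u →
        ¬ (M.wedge N).σ.SameCycle (Sum.inr N.root) u := fun hu h => hu (hc.symm.trans h)
    have hjoin := hS.of_sameCycle hc
    have hnew' := hnew (fun h => by simpa [hloopM] using hc.trans h)
      fun h => by simpa [hloopN] using hc.trans h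
    exact (hjoin.iff_of_wedge_join hM hN hnew' (hoff ha)).trans
      (hjoin.iff_of_wedge_join hM hN hnew' (hoff hb)).symm
  · rcases c with c | c
    · have hc' : ¬ M.σ.SameCycle c (M.φ M.root) := fun h => hc (by simp [h.symm, SameCycle.refl])
      exact (hS.iff_of_wedge_inl hM hc' ha).trans (hS.iff_of_wedge_inl hM hc' hb).symm
    · have hc' : ¬ N.σ.SameCycle c N.root := fun h => hc (by simp [h.symm])
      exact (hS.iff_of_wedge_inr hN hc' ha).trans (hS.iff_of_wedge_inr hN hc' hb).symm

theorem IsTD.wedge_deg (hM : M.IsTD) (hN : N.IsTD) {u : D ⊕ D'}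
    (hu : ∀ v, (M.wedge N).φ.SameCycle (Sum.inl M.root) v → v ≠ Sum.inr N.root →
      ¬ (M.wedge N).σ.SameCycle u v) :
    (M.wedge N).σ u ≠ u ∧ (M.wedge N).σ ((M.wedge N).σ u) ≠ u := by
  have hjoin := hu (Sum.inl (M.φ M.root)) (by simp [SameCycle.refl]) (by simp)
  rcases u with x | x
  · rw [sameCycle_wedge_σ_inl_inl] at hjoin
    rw [wedge_deg_inl_iff hjoin]
    exact hM.deg x fun y hy => by simpa using hu (Sum.inl y) (by simpa using hy) (by simp)
  · have hjoin' : ¬ N.σ.SameCycle x N.root := fun h => hjoin (by simp [SameCycle.refl, h.symm])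
    rw [wedge_deg_inr_iff hjoin']
    refine hN.deg x fun y hy => ?_
    by_cases hyr : y = N.root
    · rwa [hyr]
    · simpa using hu (Sum.inr y) (by simp [SameCycle.refl, hy]) (by simpa using hyr)

theorem IsTD.close_wedge (hM : M.IsTD) (hN : N.IsTD)
    (h : (M.wedge N).φ ((M.wedge N).φ (M.wedge N).root) ≠ (M.wedge N).root) :
    ((M.wedge N).close h).IsTD := by
  have hthird := wedge_φ_φ_root M N (hN.φ_ne N.root)
  have h' : (M.wedge N).φ (M.wedge N).root ≠ (M.wedge N).root := by
    rw [wedge_root, wedge_φ_root]; exact Sum.inr_ne_inl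
  have hpw : ¬ (M.wedge N).σ.SameCycle (M.wedge N).root (Sum.inr (N.φ N.root)) := by
    simp [not_sameCycle_φ hN.loopless]
  refine ⟨?_, fun hS a b ha hb => ?_, (close_internalTriangles_iff _ h h').2
    (wedge_internalTriangles_iff.2 ⟨hM.tri, hN.tri⟩), fun d hd => ?_⟩
  · rintro ((x | x) | (_ | _)) <;> rw [sameCycle_close_σ]
    · simpa using hM.loopless x
    · simpa using hN.loopless x
    · simpa only [close_α_false, retract_true, retract_false, hthird] using fun h => hpw h.symm
    · simpa only [close_α_true, retract_true, retract_false, hthird] using hpw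
  · rw [sameCycle_close_σ] at ha hb
    refine (hS.σ.iff_inl_retract h.symm a).trans
      (Iff.trans ?_ (hS.σ.iff_inl_retract h.symm b).symm)
    refine hS.of_close.iff_of_wedge hM hN (fun hroot hφ => ?_) ha hb
    have hα := hS.α (Sum.inr true) (by rwa [sameCycle_close_σ])
      (by simpa only [sameCycle_close_σ, close_α_true, retract_false, hthird] using hφ)
    rwa [hS.σ.iff_inl_retract h.symm (Sum.inr true), close_α_true,
      hS.σ.iff_inl_retract h.symm (Sum.inr false), retract_false, hthird] at hα
  · obtain ⟨u, rfl, hroot, hφ, hface⟩ := exists_inl_of_close_internal _ h h' hd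
    rw [close_deg_iff _ h hroot hφ]
    rw [wedge_root, wedge_φ_root] at hface
    exact hM.wedge_deg hN hface

open scoped Classical in
theorem IsUnionOff.exists_wedge_inl (hN : ∀ d, ¬ N.σ.SameCycle d (N.α d)) {c : D} {S : D → Prop}
    (hS : M.IsUnionOff c S) : ∃ T, (M.wedge N).IsUnionOff (Sum.inl c) T ∧ (T ∘ Sum.inl = S) ∧
      (¬ M.σ.SameCycle c M.root → (T (Sum.inr (N.φ N.root)) ↔ S M.root)) := by
  by_cases hc : M.σ.SameCycle c (M.φ M.root)
  · refine ⟨Sum.elim S fun y => if N.σ.SameCycle N.root y then S (M.φ M.root) else S M.root,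
      ⟨(isInvariant_glue_iff _ _ _ _).2 ⟨by simp [SameCycle.refl], hS.σ, fun x => by simp⟩, ?_⟩,
      rfl, fun _ => by simp [not_sameCycle_φ hN]⟩
    rintro (x | x) hx hαx
    · exact hS.α x (by simpa using hx) (by simpa using hαx)
    · have hx' : ¬ N.σ.SameCycle N.root x := by simpa [hc.symm] using hx
      have hαx' : ¬ N.σ.SameCycle N.root (N.α x) := by simpa [hc.symm] using hαx
      simp [hx', hαx']
  · refine ⟨Sum.elim S fun _ => S (M.φ M.root),
      ⟨(isInvariant_glue_iff _ _ _ _).2 ⟨Iff.rfl, hS.σ, fun x => Iff.rfl⟩, ?_⟩, rfl,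
      fun hroot => ?_⟩
    · rintro (x | x) hx hαx
      · exact hS.α x (by simpa using hx) (by simpa using hαx)
      · rfl
    · rw [φ_apply, sameCycle_apply_right] at hc
      rw [Sum.elim_inr, φ_apply, hS.σ, hS.α _ hroot hc]

open scoped Classical in
theorem IsUnionOff.exists_wedge_inr (hM : ∀ d, ¬ M.σ.SameCycle d (M.α d)) {c : D'} {S : D' → Prop}
    (hS : N.IsUnionOff c S) : ∃ T, (M.wedge N).IsUnionOff (Sum.inr c) T ∧ (T ∘ Sum.inr = S) ∧
      (¬ N.σ.SameCycle c (N.φ N.root) → (S (N.φ N.root) ↔ T (Sum.inl M.root))) := by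
  have hM' : ¬ M.σ.SameCycle (M.φ M.root) M.root := fun h => not_sameCycle_φ hM _ h.symm
  by_cases hc : N.σ.SameCycle c N.root
  · refine ⟨Sum.elim (fun x => if M.σ.SameCycle (M.φ M.root) x then S N.root else S (N.φ N.root)) S,
      ⟨(isInvariant_glue_iff _ _ _ _).2 ⟨by simp [SameCycle.refl], fun x => by simp, hS.σ⟩, ?_⟩,
      rfl, fun _ => by simp [hM']⟩
    rintro (x | x) hx hαx
    · have hx' : ¬ M.σ.SameCycle (M.φ M.root) x := by simpa [hc.symm] using hx
      have hαx' : ¬ M.σ.SameCycle (M.φ M.root) (M.α x) := by simpa [hc.symm] using hαx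
      simp [hx', hαx']
    · exact hS.α x (by simpa using hx) (by simpa using hαx)
  · refine ⟨Sum.elim (fun _ => S N.root) S,
      ⟨(isInvariant_glue_iff _ _ _ _).2 ⟨Iff.rfl, fun x => Iff.rfl, hS.σ⟩, ?_⟩, rfl,
      fun hφ => ?_⟩
    · rintro (x | x) hx hαx
      · rfl
      · exact hS.α x (by simpa using hx) (by simpa using hαx)
    · rw [φ_apply, sameCycle_apply_right] at hφ
      rw [Sum.elim_inl, φ_apply, hS.σ, hS.α _ hc hφ]

section OfClose

variable {h : (M.wedge N).φ ((M.wedge N).φ (M.wedge N).root) ≠ (M.wedge N).root}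

theorem IsTD.loopless_of_close_wedge (hC : ((M.wedge N).close h).IsTD) :
    (∀ d, ¬ M.σ.SameCycle d (M.α d)) ∧ ∀ d, ¬ N.σ.SameCycle d (N.α d) := by
  have hloop : ∀ d, ¬ (M.wedge N).σ.SameCycle d ((M.wedge N).α d) := fun d => by
    simpa only [sameCycle_close_σ, close_α_inl, retract_inl] using hC.loopless (Sum.inl d)
  exact ⟨fun d => by simpa using hloop (Sum.inl d), fun d => by simpa using hloop (Sum.inr d)⟩

theorem IsTD.nonsep_of_close_wedge (hC : ((M.wedge N).close h).IsTD) (hφ : N.φ N.root ≠ N.root)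
    {c : D ⊕ D'} {S : D ⊕ D' → Prop} (hS : (M.wedge N).IsUnionOff c S)
    (hnew : ¬ (M.wedge N).σ.SameCycle c (Sum.inl M.root) →
      ¬ (M.wedge N).σ.SameCycle c (Sum.inr (N.φ N.root)) →
      (S (Sum.inr (N.φ N.root)) ↔ S (Sum.inl M.root)))
    {a b : D ⊕ D'} (ha : ¬ (M.wedge N).σ.SameCycle c a) (hb : ¬ (M.wedge N).σ.SameCycle c b) :
    S a ↔ S b :=
  hC.nonsep (hS.close (by rwa [wedge_φ_φ_root M N hφ])) (a := Sum.inl a) (b := Sum.inl b)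
    (by rwa [sameCycle_close_σ]) (by rwa [sameCycle_close_σ])

theorem IsTD.deg_of_close_wedge (hC : ((M.wedge N).close h).IsTD) (hφ : N.φ N.root ≠ N.root)
    {u : D ⊕ D'} (hu : ∀ v, (M.wedge N).φ.SameCycle (Sum.inl M.root) v → v ≠ Sum.inr N.root →
      ¬ (M.wedge N).σ.SameCycle u v) :
    (M.wedge N).σ u ≠ u ∧ (M.wedge N).σ ((M.wedge N).σ u) ≠ u := by
  have hroot := wedge_φ_root M N
  have hthird := wedge_φ_φ_root M N hφ
  rw [← close_deg_iff _ h (hu _ (SameCycle.refl _ _) (by simp))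
    (by rw [hthird]; exact hu _ (by simp [SameCycle.refl]) (by simpa using hφ))]
  refine hC.deg _ fun v hv => ?_
  rw [sameCycle_close_σ]
  rcases (close_rootFace_iff _ h (by rw [wedge_root, hroot]; exact Sum.inr_ne_inl) v).1 hv with
    rfl | ⟨v, rfl, hv, -, hend⟩
  · exact hu _ (SameCycle.refl _ _) (by simp)
  · exact hu v hv (by rwa [wedge_root, hroot] at hend)

theorem IsTD.of_close_wedge (hC : ((M.wedge N).close h).IsTD) : M.IsTD ∧ N.IsTD := by
  obtain ⟨hM, hN⟩ := hC.loopless_of_close_wedge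
  have hφ : N.φ N.root ≠ N.root := fun hr => not_sameCycle_φ hN N.root (by rw [hr])
  obtain ⟨htriM, htriN⟩ := wedge_internalTriangles_iff.1 ((close_internalTriangles_iff _ h
    (by rw [wedge_root, wedge_φ_root]; exact Sum.inr_ne_inl)).1 hC.tri)
  refine ⟨⟨hM, fun hS a b ha hb => ?_, htriM, fun d hd => ?_⟩,
    ⟨hN, fun hS a b ha hb => ?_, htriN, fun d hd => ?_⟩⟩
  · obtain ⟨T, hT, rfl, hnew⟩ := hS.exists_wedge_inl hN
    exact hC.nonsep_of_close_wedge hφ hT (fun hroot _ => hnew (by simpa using hroot))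
      (by simpa using ha) (by simpa using hb)
  · have hend := hd _ (by simp [SameCycle.refl] : M.φ.SameCycle M.root (M.φ M.root))
    rw [← wedge_deg_inl_iff (N := N) hend]
    refine hC.deg_of_close_wedge hφ ?_
    rintro (y | y) hy -
    · simpa using hd y (by simpa using hy)
    · rw [sameCycle_wedge_σ_inl_inr]
      exact fun hx => hend hx.1.symm
  · obtain ⟨T, hT, rfl, hnew⟩ := hS.exists_wedge_inr hM
    exact hC.nonsep_of_close_wedge hφ hT (fun _ hthird => hnew (by simpa using hthird))
      (by simpa using ha) (by simpa using hb)
  · have hroot := hd _ (SameCycle.refl _ _)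
    rw [← wedge_deg_inr_iff (M := M) hroot]
    refine hC.deg_of_close_wedge hφ ?_
    rintro (y | y) hy -
    · rw [sameCycle_wedge_σ_inr_inl]
      exact fun hx => hroot hx.2.symm
    · rw [sameCycle_wedge_φ_inl_inr] at hy
      simpa using hd y hy.2

end OfClose

end WedgeClass

end RootedMap

namespace RootedMap

open Equiv (Perm)
open Equiv.Perm PermCycles

section Statistics

variable {D D' : Type*}

/-- The number of edges, that is, of cycles of `α`. -/
noncomputable def numEdges (M : RootedMap D) : ℕ := numCycles M.α

/-- The degree of the root-face, that is, the length of the cycle of `φ` through the root. -/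
noncomputable def rootDegree (M : RootedMap D) : ℕ := Nat.card {y // M.φ.SameCycle M.root y}

theorem faceDegree_rootFace (M : RootedMap D) : M.faceDegree M.rootFace = M.rootDegree :=
  M.faceDegree_rightFace _

theorem numEdges_single : single.numEdges = 1 := numCycles_boolNot

theorem rootDegree_single : single.rootDegree = 2 := by
  have hall : ∀ y, single.φ.SameCycle single.root y := by
    rintro (_ | _)
    · exact ⟨1, rfl⟩
    · exact SameCycle.refl _ _
  rw [rootDegree, Nat.card_congr (Equiv.subtypeUnivEquiv hall), Nat.card_eq_fintype_card,
    Fintype.card_bool]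

theorem rootDegree_reroot_φ (M : RootedMap D) :
    (M.reroot (M.φ M.root)).rootDegree = M.rootDegree :=
  Nat.card_congr (Equiv.subtypeEquivRight fun _ => sameCycle_apply_left)

section Iso

variable {M : RootedMap D} {N : RootedMap D'}

theorem Iso.numEdges_eq (h : M.Iso N) : M.numEdges = N.numEdges := by
  obtain ⟨e, -, hα, -⟩ := h
  exact numCycles_map e hα

theorem Iso.rootDegree_eq (h : M.Iso N) : M.rootDegree = N.rootDegree := by
  obtain ⟨e, hσ, hα, hroot⟩ := h
  refine Nat.card_congr (e.subtypeEquiv fun y => ?_)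
  rw [sameCycle_map e (map_φ hσ hα), hroot]

theorem Iso.threeLeEndDegree_iff (h : M.Iso N) : M.ThreeLeEndDegree ↔ N.ThreeLeEndDegree := by
  obtain ⟨e, hσ, hα, hroot⟩ := h
  rw [ThreeLeEndDegree, ThreeLeEndDegree, ← hroot, ← map_φ hσ hα, ← hσ, ← hσ, e.injective.ne_iff]

theorem Iso.reroot_φ (h : M.Iso N) :
    (M.reroot (M.φ M.root)).Iso (N.reroot (N.φ N.root)) := by
  obtain ⟨e, hσ, hα, hroot⟩ := h
  exact ⟨e, hσ, hα, by rw [← hroot]; exact map_φ hσ hα _⟩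

theorem Iso.of_reroot_φ (h : (M.reroot (M.φ M.root)).Iso (N.reroot (N.φ N.root))) : M.Iso N := by
  obtain ⟨e, hσ, hα, hroot⟩ := h
  refine ⟨e, hσ, hα, N.φ.injective ?_⟩
  rw [← map_φ (M := M) (N := N) hσ hα]
  exact hroot

end Iso

variable [Finite D] [Finite D']

theorem IsTD.two_le_rootDegree {M : RootedMap D} (hM : M.IsTD) : 2 ≤ M.rootDegree :=
  two_le_card_sameCycle_iff.2 (hM.φ_ne _)

theorem IsTD.three_le_rootDegree_iff {M : RootedMap D} (hM : M.IsTD) :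
    3 ≤ M.rootDegree ↔ M.φ (M.φ M.root) ≠ M.root :=
  three_le_card_sameCycle_iff.trans (and_iff_right (hM.φ_ne _))

theorem numEdges_close (M : RootedMap D) (h : M.φ (M.φ M.root) ≠ M.root) :
    (M.close h).numEdges = M.numEdges + 1 := numCycles_closeα M.α

theorem rootDegree_close (M : RootedMap D) (h : M.φ (M.φ M.root) ≠ M.root)
    (h' : M.φ M.root ≠ M.root) : (M.close h).rootDegree + 1 = M.rootDegree := by
  have hface : {u | (M.close h).φ.SameCycle (Sum.inr true) u} =
      insert (Sum.inr true) (Sum.inl '' ({x | M.φ.SameCycle M.root x} \ {M.root, M.φ M.root})) := by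
    ext u
    simp only [Set.mem_ofPred_eq, M.close_rootFace_iff h h', Set.mem_insert_iff, Set.mem_image,
      Set.mem_sdiff, Set.mem_singleton_iff, not_or, and_comm, eq_comm]
  have hsub : ({M.root, M.φ M.root} : Set D) ⊆ {x | M.φ.SameCycle M.root x} := by
    rintro x (rfl | rfl)
    · exact SameCycle.refl _ _
    · exact sameCycle_apply_right.2 (SameCycle.refl _ _)
  have hM : M.rootDegree = {x | M.φ.SameCycle M.root x}.ncard := rfl
  have hC : (M.close h).rootDegree = {u | (M.close h).φ.SameCycle (Sum.inr true) u}.ncard := rfl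
  rw [hC, hM, hface, Set.ncard_insert_of_notMem (by simp),
    Set.ncard_image_of_injective _ Sum.inl_injective, ← Set.ncard_sdiff_add_ncard_of_subset hsub,
    Set.ncard_pair h'.symm]

theorem numEdges_wedge (M : RootedMap D) (N : RootedMap D') :
    (M.wedge N).numEdges = M.numEdges + N.numEdges := numCycles_sumCongr M.α N.α

theorem rootDegree_wedge (M : RootedMap D) (N : RootedMap D') :
    (M.wedge N).rootDegree = M.rootDegree + N.rootDegree := by
  unfold rootDegree
  rw [← Nat.card_sum]
  refine Nat.card_congr (Equiv.subtypeSum.trans (Equiv.sumCongr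
    (Equiv.subtypeEquivRight fun x => ?_) (Equiv.subtypeEquivRight fun x => ?_)))
  · simp
  · simp [SameCycle.refl]

end Statistics

section Join

variable {D D' E E' : Type*} [Finite D] [Finite D'] [Finite E] [Finite E']

/-- The maps `M` and `N`, glued at a vertex, with a new root edge which forms a triangle with the
root edges of `M` and `N`. -/
noncomputable def join (M : RootedMap D) (N : RootedMap D') (h : N.φ N.root ≠ N.root) :
    RootedMap ((D ⊕ D') ⊕ Bool) :=
  (M.wedge N).close (wedge_φ_φ_root_ne M N h)

theorem numEdges_join (M : RootedMap D) (N : RootedMap D') (h : N.φ N.root ≠ N.root) :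
    (M.join N h).numEdges = M.numEdges + N.numEdges + 1 := by
  rw [join, numEdges_close, numEdges_wedge]

theorem rootDegree_join (M : RootedMap D) (N : RootedMap D') (h : N.φ N.root ≠ N.root) :
    (M.join N h).rootDegree + 1 = M.rootDegree + N.rootDegree := by
  have hφ : (M.wedge N).φ (M.wedge N).root ≠ (M.wedge N).root := by
    rw [wedge_root, wedge_φ_root]
    exact Sum.inr_ne_inl
  rw [join, rootDegree_close _ _ hφ, rootDegree_wedge]

theorem IsTD.join {M : RootedMap D} {N : RootedMap D'} (hM : M.IsTD) (hN : N.IsTD)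
    (h : N.φ N.root ≠ N.root) : (M.join N h).IsTD := hM.close_wedge hN _

theorem Iso.join {M : RootedMap D} {N : RootedMap D'} {P : RootedMap E} {Q : RootedMap E'}
    (hMP : M.Iso P) (hNQ : N.Iso Q) (h : N.φ N.root ≠ N.root) (h' : Q.φ Q.root ≠ Q.root) :
    (M.join N h).Iso (P.join Q h') :=
  (hMP.wedge hNQ).close _ _

theorem Iso.of_join {M : RootedMap D} {N : RootedMap D'} {P : RootedMap E} {Q : RootedMap E'}
    (hP : P.IsTD) (hQ : Q.IsTD) {h : N.φ N.root ≠ N.root} {h' : Q.φ Q.root ≠ Q.root}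
    (hi : (M.join N h).Iso (P.join Q h')) : M.Iso P ∧ N.Iso Q :=
  Iso.of_wedge hP hQ (Iso.of_close hi)

end Join

end RootedMap

namespace RootedMap

open Equiv (Perm)
open Equiv.Perm PermCycles

universe u

theorem single_isTD : single.IsTD := by
  have hface : ∀ d, single.φ.SameCycle single.root d := by
    rintro (_ | _)
    · exact ⟨1, rfl⟩
    · exact SameCycle.refl _ _
  refine ⟨fun d h => ?_, fun {c _} _ {a b} ha hb => ?_, fun d hd => absurd (hface d) hd,
    fun d hd => absurd (SameCycle.refl _ d) (hd d (hface d))⟩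
  · have hα := sameCycle_one.1 h
    cases d <;> simp [single] at hα
  · have hac : c ≠ a := fun h => ha (h ▸ SameCycle.refl _ _)
    have hbc : c ≠ b := fun h => hb (h ▸ SameCycle.refl _ _)
    have hab : a = b := by cases a <;> cases b <;> cases c <;> simp_all
    rw [hab]

section IsoSingle

variable {D : Type*} {M : RootedMap D}

theorem iso_single_of_forall (hall : ∀ x, x = M.root ∨ x = M.α M.root)
    (hroot : M.σ M.root = M.root) (hα : M.σ (M.α M.root) = M.α M.root) : M.Iso single := by
  let f : Bool → D := fun b => if b then M.root else M.α M.root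
  have hf : Function.Bijective f := by
    constructor
    · rintro (_ | _) (_ | _) hxy
      · rfl
      · exact absurd hxy (M.α_ne _)
      · exact absurd hxy.symm (M.α_ne _)
      · rfl
    · intro x
      rcases hall x with rfl | rfl
      · exact ⟨true, rfl⟩
      · exact ⟨false, rfl⟩
  refine Iso.symm ⟨Equiv.ofBijective f hf, ?_, ?_, rfl⟩
  · rintro (_ | _)
    · exact hα.symm
    · exact hroot.symm
  · rintro (_ | _)
    · exact (M.α_invol _).symm
    · rfl

theorem IsTD.iso_single (hM : M.IsTD)
    (h : M.σ M.root = M.root ∨ M.σ (M.α M.root) = M.α M.root) : M.Iso single := by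
  have hall : ∀ x, x = M.root ∨ x = M.α M.root := by
    rcases h with h | h
    · exact hM.eq_or_eq_of_apply_eq h
    · intro x
      have hx := hM.eq_or_eq_of_apply_eq h x
      rwa [M.α_invol, or_comm] at hx
  refine iso_single_of_forall hall ?_ ?_
  · exact (hall _).resolve_right fun hroot => hM.loopless M.root ⟨1, hroot⟩
  · exact (hall _).resolve_left fun hα => hM.loopless M.root (SameCycle.symm ⟨1, hα⟩)

end IsoSingle

section Decomposition

theorem not_iso_close_single {D : Type*} [Finite D] (M : RootedMap D)
    (h : M.φ (M.φ M.root) ≠ M.root) : ¬ (M.close h).Iso single := by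
  rintro ⟨e, -⟩
  have hcard := Nat.card_congr e
  have hpos : 0 < Nat.card D := Nat.card_pos_iff.2 ⟨⟨M.root⟩, inferInstance⟩
  rw [Nat.card_sum] at hcard
  omega

theorem IsTD.not_iso_close_join {D D' E : Type*} [Finite D] [Finite D'] [Finite E]
    {M : RootedMap D} {N : RootedMap D'} {P : RootedMap E} (hM : M.IsTD)
    (h : M.φ (M.φ M.root) ≠ M.root) (h' : P.φ P.root ≠ P.root) :
    ¬ (M.close h).Iso (N.join P h') :=
  fun hi => wedge_not_isTD (hM.of_iso (Iso.of_close hi))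

variable {D : Type u} [Finite D]

/-- The end of the root is then a cut vertex of `M`. -/
theorem exists_iso_wedge_of_close {M : RootedMap D} {h : M.φ (M.φ M.root) ≠ M.root}
    (hloop : ∀ d, ¬ M.σ.SameCycle d (M.α d)) {u : D ⊕ Bool}
    (hface : (M.close h).φ.SameCycle (Sum.inr true) u)
    (hend : (M.close h).σ.SameCycle (Sum.inl (M.φ M.root)) u) :
    ∃ (D₁ D₂ : Type u) (_ : Finite D₁) (_ : Finite D₂) (M₁ : RootedMap D₁) (M₂ : RootedMap D₂),
      M.Iso (M₁.wedge M₂) := by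
  have hne := not_sameCycle_φ hloop
  have hφ : M.φ M.root ≠ M.root := fun hr => hne M.root (by rw [hr])
  rw [sameCycle_close_σ] at hend
  rcases (M.close_rootFace_iff h hφ u).1 hface with rfl | ⟨s, rfl, hroot, _, hs⟩
  · exact absurd hend.symm (hne _)
  · exact M.exists_iso_wedge hs hend.symm (sameCycle_apply_right.2 hroot.symm)

theorem IsTD.iso_single_or_close_or_join {M : RootedMap D} (hM : M.IsTD) : M.Iso single ∨
    (∃ (E : Type u) (_ : Finite E) (N : RootedMap E) (h : N.φ (N.φ N.root) ≠ N.root),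
      M.Iso (N.close h) ∧ N.IsTD ∧ N.ThreeLeEndDegree) ∨
    ∃ (E F : Type u) (_ : Finite E) (_ : Finite F) (N : RootedMap E) (P : RootedMap F)
      (h : P.φ P.root ≠ P.root), M.Iso (N.join P h) ∧ N.IsTD ∧ P.IsTD := by
  by_cases hfix : M.σ (M.α M.root) = M.α M.root
  · exact Or.inl (hM.iso_single (Or.inr hfix))
  obtain ⟨E, _, N, h, hMN⟩ := hM.exists_iso_close hfix
  have hC := hM.of_iso hMN
  by_cases hint : ∀ y, (N.close h).φ.SameCycle (Sum.inr true) y →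
      ¬ (N.close h).σ.SameCycle (Sum.inl (N.φ N.root)) y
  · exact Or.inr (Or.inl ⟨E, inferInstance, N, h, hMN, hC.of_close hint⟩)
  · push Not at hint
    obtain ⟨u, hface, hend⟩ := hint
    have hloop : ∀ d, ¬ N.σ.SameCycle d (N.α d) := fun d => by
      simpa only [sameCycle_close_σ, close_α_inl, retract_inl] using hC.loopless (Sum.inl d)
    obtain ⟨A, B, _, _, P, Q, hPQ⟩ := exists_iso_wedge_of_close hloop hface hend
    have hclosable : (P.wedge Q).φ ((P.wedge Q).φ (P.wedge Q).root) ≠ (P.wedge Q).root := by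
      obtain ⟨e, hσ, hα, hroot⟩ := hPQ
      rwa [← hroot, ← map_φ hσ hα, ← map_φ hσ hα, e.injective.ne_iff]
    have hiso : M.Iso ((P.wedge Q).close hclosable) := hMN.trans (hPQ.close h hclosable)
    obtain ⟨hP, hQ⟩ := IsTD.of_close_wedge (hM.of_iso hiso)
    exact Or.inr (Or.inr ⟨A, B, inferInstance, inferInstance, P, Q, hQ.φ_ne _, hiso, hP, hQ⟩)

end Decomposition

section RootDegreeTwo

variable {D : Type u} [Finite D]

theorem apply_root_eq_of_close {M : RootedMap D} {h : M.φ (M.φ M.root) ≠ M.root}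
    (hC : (M.close h).σ ((M.close h).σ (M.close h).root) = (M.close h).root) :
    M.σ M.root = M.root := by
  rw [close_root, close_σ_true] at hC
  rcases closeσ_inl_cases M.σ h.symm M.root with ⟨_, hσ⟩ | ⟨hroot, _⟩ | ⟨_, _, hσ⟩
  · have := hσ.symm.trans hC
    simp at this
  · exact hroot
  · exact absurd (hσ.symm.trans hC) Sum.inl_ne_inr

theorem apply_root_eq_of_wedge {D' : Type*} [Finite D'] {M : RootedMap D} {N : RootedMap D'}
    (hW : (M.wedge N).σ (M.wedge N).root = (M.wedge N).root) : M.σ M.root = M.root := by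
  by_cases hend : M.σ M.root = M.φ M.root
  · rw [wedge_root, wedge_σ_inl_of_eq M N hend] at hW
    exact absurd hW Sum.inr_ne_inl
  · rw [wedge_root, wedge_σ_inl M N hend] at hW
    exact Sum.inl.inj hW

theorem IsTD.exists_iso_join_single {M : RootedMap D} (hM : M.IsTD)
    (hface : M.φ (M.φ M.root) ≠ M.root) (hroot : M.σ (M.σ M.root) = M.root) :
    ∃ (E : Type u) (_ : Finite E) (N : RootedMap E) (h : N.φ N.root ≠ N.root),
      M.Iso (single.join N h) ∧ N.IsTD := by
  have apply_root_eq : ∀ {E : Type u} [Finite E] {N : RootedMap E}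
      {h : N.φ (N.φ N.root) ≠ N.root}, M.Iso (N.close h) → N.σ N.root = N.root := by
    rintro E _ N h ⟨e, hσ, -, he⟩
    exact apply_root_eq_of_close (h := h) (by rw [← he, ← hσ, ← hσ, hroot])
  rcases hM.iso_single_or_close_or_join with hs | ⟨E, _, N, h, hi, hN, _⟩ |
    ⟨E, F, _, _, N, P, h, hi, hN, hP⟩
  · obtain ⟨e, hσ, hα, he⟩ := hs
    refine absurd (e.injective ?_) hface
    rw [map_φ hσ hα, map_φ hσ hα, he]
    rfl
  · have hfix := apply_root_eq hi
    have hφ : N.φ N.root = N.α N.root :=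
      (hN.eq_or_eq_of_apply_eq hfix _).resolve_left (hN.φ_ne _)
    refine absurd ?_ h
    rw [hφ, φ_apply, N.α_invol, hfix]
  · have hfix := apply_root_eq_of_wedge (apply_root_eq hi)
    exact ⟨F, inferInstance, P, h,
      hi.trans ((hN.iso_single (Or.inl hfix)).join (Iso.refl P) h h), hP⟩

theorem σ_σ_root_join_single (N : RootedMap D) (h : N.φ N.root ≠ N.root) :
    (single.join N h).σ ((single.join N h).σ (single.join N h).root) =
      (single.join N h).root := by
  rw [join, close_root, close_σ_true]
  refine closeσ_inl_of_eq_left _ (wedge_φ_φ_root_ne single N h).symm ?_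
  exact wedge_σ_inl single N (x := true) (by simp [single, φ_apply])

theorem IsTD.exists_iso_reroot_join_single {N : RootedMap D} (hN : N.IsTD)
    (h : N.φ N.root ≠ N.root) :
    ∃ (E : Type u) (_ : Finite E) (M : RootedMap E), M.IsTD ∧ ¬ M.ThreeLeEndDegree ∧
      (M.reroot (M.φ M.root)).Iso (single.join N h) := by
  set P := single.join N h
  have hφ : P.φ (P.φ.symm P.root) = P.root := P.φ.apply_symm_apply P.root
  refine ⟨_, inferInstance, P.reroot (P.φ.symm P.root),
    (single_isTD.join hN h).reroot (by rw [← sameCycle_apply_right, hφ]),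
    not_not.2 ?_, ?_⟩
  · change P.σ (P.σ (P.φ (P.φ.symm P.root))) = P.φ (P.φ.symm P.root)
    rw [hφ]
    exact σ_σ_root_join_single N h
  · change (P.reroot (P.φ (P.φ.symm P.root))).Iso P
    rw [hφ]
    exact Iso.refl P

end RootDegreeTwo

end RootedMap

instance RootedMap.finite {D : Type*} [Finite D] : Finite (RootedMap D) := by
  refine Finite.of_injective (fun M : RootedMap D => (M.σ, M.α, M.root)) ?_
  rintro ⟨σ, α, r, _, _, _, _⟩ ⟨σ', α', r', _, _, _, _⟩ h
  simp only [Prod.mk.injEq] at h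
  obtain ⟨rfl, rfl, rfl⟩ := h
  rfl

/-- A map of the class `T`, on any finite set of darts. -/
structure TMap : Type 1 where
  D : Type
  finite : Finite D
  M : RootedMap D
  isTD : M.IsTD

attribute [instance] TMap.finite

instance TMap.setoid : Setoid TMap where
  r A B := A.M.Iso B.M
  iseqv := ⟨fun A => RootedMap.Iso.refl A.M, fun h => h.symm, fun h h' => h.trans h'⟩

/-- Isomorphism classes of maps of the class `T`, whatever the number of edges. -/
def TClass : Type 1 := Quotient TMap.setoid

namespace TClass

open RootedMap
open Equiv.Perm

variable {D D' : Type} [Finite D] [Finite D'] {M : RootedMap D} {N : RootedMap D'}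

/-- The class of a map. -/
def mk (M : RootedMap D) (hM : M.IsTD) : TClass := Quotient.mk TMap.setoid ⟨D, inferInstance, M, hM⟩

theorem mk_eq_iff {hM : M.IsTD} {hN : N.IsTD} : mk M hM = mk N hN ↔ M.Iso N :=
  Quotient.eq (r := TMap.setoid)

theorem ind {p : TClass → Prop} (h : ∀ {D : Type} [Finite D] (M : RootedMap D) (hM : M.IsTD),
    p (mk M hM)) (c : TClass) : p c :=
  Quotient.ind (fun A => h A.M A.isTD) c

/-- A representative of a class. -/
noncomputable def rep (c : TClass) : TMap := Quotient.out (s := TMap.setoid) c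

theorem mk_rep (c : TClass) : mk c.rep.M c.rep.isTD = c := Quotient.out_eq (s := TMap.setoid) c

theorem iso_rep (M : RootedMap D) (hM : M.IsTD) : M.Iso (mk M hM).rep.M := by
  rw [← mk_eq_iff (hM := hM) (hN := (mk M hM).rep.isTD), mk_rep]

section Statistics

/-- The number of edges. -/
noncomputable def edges : TClass → ℕ :=
  Quotient.lift (fun A => A.M.numEdges) fun _ _ h => h.numEdges_eq

/-- The degree of the root-face, minus two. -/
noncomputable def excess : TClass → ℕ :=
  Quotient.lift (fun A => A.M.rootDegree - 2) fun _ _ h => congrArg (· - 2) h.rootDegree_eq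

/-- The end of the root has degree at least three. -/
def ThreeLeEndDegree : TClass → Prop :=
  Quotient.lift (fun A => A.M.ThreeLeEndDegree) fun _ _ h => propext h.threeLeEndDegree_iff

theorem edges_mk (hM : M.IsTD) : (mk M hM).edges = M.numEdges := rfl

theorem excess_mk_add_two (hM : M.IsTD) : (mk M hM).excess + 2 = M.rootDegree :=
  Nat.sub_add_cancel hM.two_le_rootDegree

theorem excess_mk_pos_iff (hM : M.IsTD) : 0 < (mk M hM).excess ↔ M.φ (M.φ M.root) ≠ M.root := by
  rw [← hM.three_le_rootDegree_iff, ← excess_mk_add_two hM]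
  omega

end Statistics

section Operations

/-- The class of the map with a single edge. -/
def singleEdge : TClass := mk single single_isTD

/-- The classes of the maps to which `RootedMap.close` applies within the class `T`. -/
def Closable : Type 1 := {c : TClass // 0 < c.excess ∧ c.ThreeLeEndDegree}

/-- `RootedMap.close` on isomorphism classes. -/
noncomputable def close (c : Closable) : TClass :=
  have hc : 0 < (mk c.1.rep.M c.1.rep.isTD).excess ∧
    (mk c.1.rep.M c.1.rep.isTD).ThreeLeEndDegree := (mk_rep c.1).symm ▸ c.2
  mk (c.1.rep.M.close ((excess_mk_pos_iff _).1 hc.1)) (c.1.rep.isTD.close _ hc.2)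

/-- `RootedMap.join` on isomorphism classes. -/
noncomputable def join : TClass → TClass → TClass :=
  Quotient.map₂ (fun A B => ⟨_, inferInstance, A.M.join B.M (B.isTD.φ_ne _), A.isTD.join B.isTD _⟩)
    fun _ _ h B B' h' => h.join h' (B.isTD.φ_ne _) (B'.isTD.φ_ne _)

/-- The class obtained by moving the root one step along the root-face. -/
def next : TClass → TClass :=
  Quotient.map (fun A => ⟨_, A.finite, _, A.isTD.reroot (r := A.M.φ A.M.root)
    (sameCycle_apply_right.2 (SameCycle.refl _ _))⟩)
    fun _ _ h => h.reroot_φ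

theorem edges_singleEdge : singleEdge.edges = 1 := numEdges_single

theorem excess_singleEdge : singleEdge.excess = 0 :=
  Nat.add_right_cancel ((excess_mk_add_two single_isTD).trans rootDegree_single)

theorem close_mk (hM : M.IsTD) (hc : 0 < (mk M hM).excess ∧ (mk M hM).ThreeLeEndDegree) :
    close ⟨mk M hM, hc⟩ =
      mk (M.close ((excess_mk_pos_iff hM).1 hc.1)) (hM.close _ hc.2) :=
  mk_eq_iff.2 ((iso_rep M hM).symm.close _ _)

theorem edges_close : ∀ c : Closable, (close c).edges = c.1.edges + 1 := by
  rintro ⟨c, hc⟩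
  induction c using ind with | _ M hM
  rw [close_mk, edges_mk, edges_mk, numEdges_close]

theorem excess_close : ∀ c : Closable, (close c).excess + 1 = c.1.excess := by
  rintro ⟨c, hc⟩
  induction c using ind with | _ M hM
  refine Nat.add_right_cancel (m := 2) ?_
  rw [close_mk, add_right_comm, excess_mk_add_two, rootDegree_close _ _ (hM.φ_ne _),
    excess_mk_add_two]

theorem close_injective : Function.Injective close := by
  rintro ⟨c, hc⟩ ⟨d, hd⟩ h
  induction c using ind with | _ M hM
  induction d using ind with | _ N hN
  rw [close_mk, close_mk, mk_eq_iff] at h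
  exact Subtype.ext (mk_eq_iff.2 h.of_close)

theorem join_mk (hM : M.IsTD) (hN : N.IsTD) :
    (mk M hM).join (mk N hN) = mk (M.join N (hN.φ_ne _)) (hM.join hN _) := rfl

theorem edges_join (a b : TClass) : (a.join b).edges = a.edges + b.edges + 1 := by
  induction a using ind with | _ M hM
  induction b using ind with | _ N hN
  exact numEdges_join M N (hN.φ_ne _)

theorem excess_join (a b : TClass) : (a.join b).excess = a.excess + b.excess + 1 := by
  induction a using ind with | _ M hM
  induction b using ind with | _ N hN
  have hjoin := rootDegree_join M N (hN.φ_ne _)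
  rw [← excess_mk_add_two hM, ← excess_mk_add_two hN, ← excess_mk_add_two (hM.join hN _)] at hjoin
  rw [join_mk]
  omega

theorem join_injective2 : Function.Injective2 join := by
  intro a a' b b' h
  induction a using ind with | _ M hM
  induction a' using ind with | _ M' hM'
  induction b using ind with | _ N hN
  induction b' using ind with | _ N' hN'
  rw [join_mk, join_mk, mk_eq_iff] at h
  exact (Iso.of_join hM' hN' h).imp mk_eq_iff.2 mk_eq_iff.2

theorem edges_next (c : TClass) : c.next.edges = c.edges := by
  induction c using ind with | _ M hM
  rfl

theorem excess_next (c : TClass) : c.next.excess = c.excess := by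
  induction c using ind with | _ M hM
  exact congrArg (· - 2) (rootDegree_reroot_φ M)

theorem next_injective : Function.Injective next := by
  intro c d h
  induction c using ind with | _ M hM
  induction d using ind with | _ N hN
  exact mk_eq_iff.2 (Iso.of_reroot_φ (mk_eq_iff.1 h))

theorem exists_next_eq_singleEdge_join (c : TClass) :
    ∃ d : TClass, ¬ d.ThreeLeEndDegree ∧ d.next = singleEdge.join c := by
  induction c using ind with | _ N hN
  obtain ⟨E, _, M, hM, hend, hi⟩ := hN.exists_iso_reroot_join_single (hN.φ_ne _)
  exact ⟨mk M hM, hend, mk_eq_iff.2 hi⟩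

/-- The class obtained by gluing to the root a triangle whose two other sides are on the
root-face; the root ends at the new vertex. -/
noncomputable def addCorner (c : TClass) : TClass := (exists_next_eq_singleEdge_join c).choose

theorem not_threeLeEndDegree_addCorner (c : TClass) : ¬ c.addCorner.ThreeLeEndDegree :=
  (exists_next_eq_singleEdge_join c).choose_spec.1

theorem next_addCorner (c : TClass) : c.addCorner.next = singleEdge.join c :=
  (exists_next_eq_singleEdge_join c).choose_spec.2

theorem edges_addCorner (c : TClass) : c.addCorner.edges = c.edges + 2 := by
  rw [← edges_next, next_addCorner, edges_join, edges_singleEdge]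
  omega

theorem excess_addCorner (c : TClass) : c.addCorner.excess = c.excess + 1 := by
  rw [← excess_next, next_addCorner, excess_join, excess_singleEdge, zero_add]

theorem addCorner_injective : Function.Injective addCorner := fun c d h =>
  (join_injective2 (by rw [← next_addCorner, h, next_addCorner])).2

theorem exists_addCorner_eq {c : TClass} (hpos : 0 < c.excess) (hend : ¬ c.ThreeLeEndDegree) :
    ∃ d : TClass, d.addCorner = c := by
  rw [← excess_next] at hpos
  induction c using ind with | _ M hM
  obtain ⟨E, _, N, hφ, hi, hN⟩ := IsTD.exists_iso_join_single (hM.reroot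
    (sameCycle_apply_right.2 (SameCycle.refl _ _))) ((excess_mk_pos_iff _).1 hpos) (not_not.1 hend)
  refine ⟨mk N hN, next_injective ?_⟩
  rw [next_addCorner]
  exact mk_eq_iff.2 hi.symm

end Operations

section Decomposition

/-- A class is a single edge, a join, or a closure. -/
noncomputable def compose : Unit ⊕ (TClass × TClass) ⊕ Closable → TClass :=
  Sum.elim (fun _ => singleEdge) (Sum.elim (Function.uncurry join) close)

theorem compose_injective : Function.Injective compose := by
  have join_ne_singleEdge : ∀ p : TClass × TClass, Function.uncurry join p ≠ singleEdge := by
    rintro ⟨a, b⟩ h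
    induction a using ind with | _ M hM
    induction b using ind with | _ N hN
    exact not_iso_close_single _ _ (mk_eq_iff.1 h)
  have close_ne_singleEdge : ∀ c, close c ≠ singleEdge := fun c h =>
    not_iso_close_single _ _ (mk_eq_iff.1 h)
  have join_ne_close : ∀ (p : TClass × TClass) c, Function.uncurry join p ≠ close c := by
    rintro ⟨a, b⟩ c h
    induction a using ind with | _ M hM
    induction b using ind with | _ N hN
    exact c.1.rep.isTD.not_iso_close_join _ (hN.φ_ne _) (mk_eq_iff.1 h).symm
  exact (Function.injective_of_subsingleton _).sumElim
    (join_injective2.uncurry.sumElim close_injective join_ne_close)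
    (fun _ => Sum.rec (fun p => (join_ne_singleEdge p).symm) fun c => (close_ne_singleEdge c).symm)

theorem compose_surjective : Function.Surjective compose := by
  intro c
  induction c using ind with | _ M hM
  rcases hM.iso_single_or_close_or_join with h | ⟨E, _, N, h, hi, hN, hend⟩ |
      ⟨E, F, _, _, N, P, h, hi, hN, hP⟩
  · exact ⟨Sum.inl (), mk_eq_iff.2 h.symm⟩
  · exact ⟨Sum.inr (Sum.inr ⟨mk N hN, (excess_mk_pos_iff hN).2 h, hend⟩),
      (close_mk hN _).trans (mk_eq_iff.2 hi.symm)⟩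
  · exact ⟨Sum.inr (Sum.inl (mk N hN, mk P hP)), mk_eq_iff.2 hi.symm⟩

theorem edges_compose : edges ∘ compose = Sum.elim (fun _ => 1)
    (Sum.elim (fun p => p.1.edges + p.2.edges + 1) fun c => c.1.edges + 1) := by
  ext x
  rcases x with _ | p | c
  exacts [edges_singleEdge, edges_join p.1 p.2, edges_close c]

theorem excess_compose : excess ∘ compose = Sum.elim (fun _ => 0)
    (Sum.elim (fun p => p.1.excess + p.2.excess + 1) fun c => (close c).excess) := by
  ext x
  rcases x with _ | p | c
  exacts [excess_singleEdge, excess_join p.1 p.2, rfl]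

/-- A class with root-face of degree at least three is closable or comes from `addCorner`. -/
noncomputable def composePos : Closable ⊕ TClass → {c : TClass // 0 < c.excess} :=
  Sum.elim (fun c => ⟨c.1, c.2.1⟩) fun c =>
    ⟨c.addCorner, (excess_addCorner c).symm ▸ Nat.succ_pos _⟩

theorem composePos_bijective : Function.Bijective composePos := by
  constructor
  · refine Function.Injective.of_comp (f := Subtype.val) ?_
    rw [composePos, Sum.comp_elim]
    refine Subtype.val_injective.sumElim addCorner_injective fun c d h => ?_
    replace h : c.1 = d.addCorner := h
    exact not_threeLeEndDegree_addCorner d (h ▸ c.2.2)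
  · rintro ⟨c, hpos⟩
    by_cases hend : c.ThreeLeEndDegree
    · exact ⟨Sum.inl ⟨c, hpos, hend⟩, rfl⟩
    · obtain ⟨d, rfl⟩ := exists_addCorner_eq hpos hend
      exact ⟨Sum.inr d, rfl⟩

theorem edges_composePos :
    (fun x => (composePos x).1.edges) = Sum.elim (fun c => c.1.edges) fun c => c.edges + 2 := by
  ext x
  rcases x with c | c
  exacts [rfl, edges_addCorner c]

theorem excess_composePos : (fun x => (composePos x).1.excess) =
    Sum.elim (fun c => (close c).excess + 1) fun c => c.excess + 1 := by
  ext x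
  rcases x with c | c
  exacts [(excess_close c).symm, excess_addCorner c]

end Decomposition

end TClass

section GeneratingFunctions

open Finset.HasAntidiagonal (antidiagonal mem_antidiagonal)

/-- The generating function `∑ x ^ e a * z ^ w a` of a type whose elements `a` carry two weights
`w a` and `e a`, as a power series in `z` with polynomial coefficients in `x`. It is meaningful when
`w` has finite fibres. -/
noncomputable def genFun {A : Type*} (w e : A → ℕ) : PowerSeries (Polynomial ℤ) :=
  PowerSeries.mk fun n => ∑ᶠ (a) (_ : w a = n), Polynomial.X ^ e a

/-- A weight that takes each value finitely often. -/
def FiniteFibers {A : Type*} (w : A → ℕ) : Prop := ∀ n, {a | w a = n}.Finite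

variable {A B : Type*} {w e : A → ℕ} {w' e' : B → ℕ}

theorem FiniteFibers.comp_injective (hw : FiniteFibers w) {f : B → A} (hf : Function.Injective f) :
    FiniteFibers fun b => w (f b) :=
  fun n => (hw n).preimage hf.injOn

theorem FiniteFibers.add_one (hw : FiniteFibers w) : FiniteFibers fun a => w a + 1 := by
  rintro (_ | n)
  · simp
  · simpa using hw n

theorem FiniteFibers.sumElim (hw : FiniteFibers w) (hw' : FiniteFibers w') :
    FiniteFibers (Sum.elim w w') := fun n => by
  refine (((hw n).image Sum.inl).union ((hw' n).image Sum.inr)).subset ?_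
  rintro (a | b) h
  · exact Or.inl ⟨a, h, rfl⟩
  · exact Or.inr ⟨b, h, rfl⟩

theorem FiniteFibers.prod (hw : FiniteFibers w) (hw' : FiniteFibers w') :
    FiniteFibers fun p : A × B => w p.1 + w' p.2 := fun n => by
  refine (((antidiagonal n).finite_toSet.biUnion fun q _ =>
    (hw q.1).prod (hw' q.2))).subset fun p hp => ?_
  exact Set.mem_biUnion (x := (w p.1, w' p.2)) (by simpa using hp) ⟨rfl, rfl⟩

theorem coeff_genFun (hw : FiniteFibers w) (n : ℕ) :
    PowerSeries.coeff n (genFun w e) = ∑ a ∈ (hw n).toFinset, Polynomial.X ^ e a := by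
  rw [genFun, PowerSeries.coeff_mk]
  exact finsum_mem_eq_finite_toFinset_sum _ (hw n)

theorem coeff_coeff_genFun (hw : FiniteFibers w) (n d : ℕ) :
    (PowerSeries.coeff n (genFun w e)).coeff d = Nat.card {a // w a = n ∧ e a = d} := by
  rw [coeff_genFun hw, Polynomial.finsetSum_coeff]
  simp only [Polynomial.coeff_X_pow, Finset.sum_boole, Nat.cast_inj]
  exact (Nat.subtype_card _ fun a => by simp [eq_comm]).symm

theorem genFun_comp_equiv (f : B ≃ A) : genFun (fun b => w (f b)) (fun b => e (f b)) = genFun w e :=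
  congrArg PowerSeries.mk <| funext fun n =>
    finsum_comp_equiv f (f := fun a => ∑ᶠ _ : w a = n, Polynomial.X ^ e a)

theorem genFun_sumElim (hw : FiniteFibers w) (hw' : FiniteFibers w') :
    genFun (Sum.elim w w') (Sum.elim e e') = genFun w e + genFun w' e' := by
  ext1 n
  rw [map_add, coeff_genFun hw, coeff_genFun hw', coeff_genFun (hw.sumElim hw')]
  rw [show ((hw.sumElim hw') n).toFinset = (hw n).toFinset.disjSum (hw' n).toFinset by
    ext (a | b) <;> simp, Finset.sum_disjSum]
  rfl

theorem genFun_prod (hw : FiniteFibers w) (hw' : FiniteFibers w') :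
    genFun (fun p : A × B => w p.1 + w' p.2) (fun p => e p.1 + e' p.2) =
      genFun w e * genFun w' e' := by
  classical
  ext1 n
  have hmaps : ∀ p ∈ (hw.prod hw' n).toFinset, (w p.1, w' p.2) ∈ antidiagonal n := by simp
  rw [PowerSeries.coeff_mul, coeff_genFun (hw.prod hw'), ← Finset.sum_fiberwise_of_maps_to hmaps]
  refine Finset.sum_congr rfl fun q hq => ?_
  rw [coeff_genFun hw, coeff_genFun hw', Finset.sum_mul_sum, ← Finset.sum_product']
  refine Finset.sum_congr ?_ fun p _ => pow_add _ _ _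
  ext p
  have := mem_antidiagonal.1 hq
  simp [Prod.ext_iff]
  omega

theorem genFun_add_one_left : genFun (fun a => w a + 1) e = PowerSeries.X * genFun w e := by
  ext1 n
  cases n with
  | zero => simp [genFun]
  | succ n => simp [genFun, PowerSeries.coeff_succ_X_mul]

theorem genFun_add_one_right :
    genFun w (fun a => e a + 1) = PowerSeries.C Polynomial.X * genFun w e := by
  ext1 n
  rw [PowerSeries.coeff_C_mul, genFun, genFun, PowerSeries.coeff_mk, PowerSeries.coeff_mk]
  have hinj := mul_right_injective₀ (Polynomial.X_ne_zero (R := ℤ))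
  rw [← AddMonoidHom.coe_mulLeft, AddMonoidHom.map_finsum_of_injective _ hinj]
  refine finsum_congr fun a => ?_
  rw [AddMonoidHom.map_finsum_of_injective _ hinj]
  exact finsum_congr fun _ => pow_succ' _ _

theorem genFun_unit : genFun (fun _ : Unit => 0) (fun _ => 0) = 1 := by
  ext1 n
  simp only [genFun, PowerSeries.coeff_mk, PowerSeries.coeff_one, finsum_unique, pow_zero,
    finsum_eq_if, eq_comm]

theorem genFun_sub_atZero (hw : FiniteFibers w) : genFun w e - atZero (genFun w e) =
    genFun (fun a : {a // 0 < e a} => w a) (fun a => e a) := by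
  ext n d
  rw [map_sub, Polynomial.coeff_sub, atZero, PowerSeries.coeff_mk,
    coeff_coeff_genFun (hw.comp_injective Subtype.val_injective)]
  cases d with
  | zero =>
    rw [Polynomial.coeff_C_zero, Polynomial.coeff_zero_eq_eval_zero, sub_self, eq_comm,
      Nat.cast_eq_zero, Nat.card_eq_zero]
    exact Or.inl ⟨fun a => a.1.2.ne' a.2.2⟩
  | succ d =>
    rw [Polynomial.coeff_C_succ, sub_zero, coeff_coeff_genFun hw, Nat.cast_inj]
    exact Nat.card_congr
      { toFun := fun a => ⟨⟨a.1, a.2.2.symm ▸ d.succ_pos⟩, a.2⟩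
        invFun := fun a => ⟨a.1, a.2⟩
        left_inv := fun _ => rfl
        right_inv := fun _ => rfl }

end GeneratingFunctions

namespace TClass

open RootedMap

section Counting

theorem mk_transport {D D' : Type} [Finite D] [Finite D'] {M : RootedMap D} (hM : M.IsTD)
    (e : D ≃ D') : mk (M.transport e) (hM.of_iso (M.iso_transport e)) = mk M hM :=
  mk_eq_iff.2 (M.iso_transport e).symm

theorem exists_mk_eq_iff (c : TClass) (n : ℕ) :
    (∃ (M : RootedMap (Fin (2 * n))) (hM : M.IsTD), mk M hM = c) ↔ c.edges = n := by
  constructor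
  · rintro ⟨M, hM, rfl⟩
    have hdarts := M.two_mul_numCycles_α
    rw [Nat.card_fin] at hdarts
    exact Nat.eq_of_mul_eq_mul_left two_pos hdarts
  · rintro rfl
    induction c using ind with | @h D _ M hM
    exact ⟨_, _, mk_transport hM (Finite.equivFinOfCardEq M.two_mul_numCycles_α.symm)⟩

theorem finiteFibers_edges : FiniteFibers edges := fun n => by
  refine (Set.finite_range fun M : {M : RootedMap (Fin (2 * n)) // M.IsTD} =>
    mk M.1 M.2).subset fun c hc => ?_
  obtain ⟨M, hM, rfl⟩ := (exists_mk_eq_iff c n).2 hc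
  exact ⟨⟨M, hM⟩, rfl⟩

theorem countT_eq_card (n d : ℕ) :
    countT n d = Nat.card {c : TClass // c.edges = n ∧ c.excess = d} := by
  refine Nat.card_congr (Equiv.ofBijective (Quotient.lift (fun M =>
    ⟨mk M.1 ((isT_iff _).1 M.2.1), (exists_mk_eq_iff _ n).1 ⟨_, _, rfl⟩, ?_⟩) ?_) ⟨?_, ?_⟩)
  · rw [← Nat.add_right_cancel_iff (n := 2), excess_mk_add_two, ← faceDegree_rootFace, M.2.2]
  · exact fun M N h => Subtype.ext (mk_eq_iff.2 h)
  · rintro ⟨M⟩ ⟨N⟩ h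
    exact Quotient.sound (mk_eq_iff.1 (congrArg Subtype.val h))
  · rintro ⟨c, hedges, hexcess⟩
    obtain ⟨M, hM, rfl⟩ := (exists_mk_eq_iff c n).2 hedges
    refine ⟨Quotient.mk _ ⟨M, (isT_iff _).2 hM, ?_⟩, rfl⟩
    rw [faceDegree_rootFace, ← excess_mk_add_two hM, hexcess]

theorem seriesT_eq_genFun : seriesT = genFun edges excess := by
  ext n d
  rw [coeff_coeff_seriesT, coeff_coeff_genFun finiteFibers_edges, countT_eq_card]

end Counting

section FunctionalEquation

theorem finiteFibers_closable : FiniteFibers fun c : Closable => c.1.edges :=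
  finiteFibers_edges.comp_injective Subtype.val_injective

/-- The generating function of the class `T` restricted to closable maps, divided by `x`. -/
noncomputable def closableSeries : PowerSeries (Polynomial ℤ) :=
  genFun (fun c : Closable => c.1.edges) fun c => (close c).excess

theorem seriesT_eq_add : seriesT = PowerSeries.X +
    PowerSeries.X * (PowerSeries.C Polynomial.X * seriesT ^ 2) +
    PowerSeries.X * closableSeries := by
  have hunit : FiniteFibers fun _ : Unit => 0 := fun _ => Set.toFinite _
  have hpairs := finiteFibers_edges.prod finiteFibers_edges
  calc seriesT = genFun (edges ∘ compose) (excess ∘ compose) := by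
        rw [seriesT_eq_genFun]
        exact (genFun_comp_equiv
          (.ofBijective compose ⟨compose_injective, compose_surjective⟩)).symm
    _ = genFun (fun _ : Unit => 0 + 1) (fun _ => 0) +
        (genFun (fun p : TClass × TClass => p.1.edges + p.2.edges + 1)
          (fun p => p.1.excess + p.2.excess + 1) +
        genFun (fun c : Closable => c.1.edges + 1) fun c => (close c).excess) := by
        rw [edges_compose, excess_compose, genFun_sumElim hunit.add_one
          (hpairs.add_one.sumElim finiteFibers_closable.add_one),
          genFun_sumElim hpairs.add_one finiteFibers_closable.add_one]
    _ = _ := by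
        rw [genFun_add_one_left, genFun_add_one_left, genFun_add_one_left, genFun_add_one_right,
          genFun_unit, genFun_prod finiteFibers_edges finiteFibers_edges, ← seriesT_eq_genFun,
          closableSeries, mul_one, ← sq, add_assoc]

theorem seriesT_sub_atZero : seriesT - atZero seriesT =
    PowerSeries.C Polynomial.X * (closableSeries + PowerSeries.X ^ 2 * seriesT) := by
  calc seriesT - atZero seriesT =
        genFun (fun x => (composePos x).1.edges) fun x => (composePos x).1.excess := by
        rw [seriesT_eq_genFun, genFun_sub_atZero finiteFibers_edges]
        exact (genFun_comp_equiv (.ofBijective composePos composePos_bijective)).symm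
    _ = genFun (fun c : Closable => c.1.edges) (fun c => (close c).excess + 1) +
        genFun (fun c => edges c + 1 + 1) fun c => c.excess + 1 := by
        rw [edges_composePos, excess_composePos,
          genFun_sumElim finiteFibers_closable finiteFibers_edges.add_one.add_one]
    _ = _ := by
        rw [genFun_add_one_right, genFun_add_one_right, genFun_add_one_left, genFun_add_one_left,
          ← seriesT_eq_genFun, closableSeries]
        ring

end FunctionalEquation

end TClass

theorem mainTheorem9 :
    let x : PowerSeries (Polynomial ℤ) := PowerSeries.C Polynomial.X
    let z : PowerSeries (Polynomial ℤ) := PowerSeries.X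
    let T : PowerSeries (Polynomial ℤ) := seriesT
    ∃ Q : PowerSeries (Polynomial ℤ),
      x * Q = T - atZero T ∧ T = z + x * z * T ^ 2 + z * Q - z ^ 3 * T := by
  intro x z T
  refine ⟨TClass.closableSeries + z ^ 2 * T, TClass.seriesT_sub_atZero.symm, ?_⟩
  calc T = z + z * (x * T ^ 2) + z * TClass.closableSeries := TClass.seriesT_eq_add
    _ = z + x * z * T ^ 2 + z * (TClass.closableSeries + z ^ 2 * T) - z ^ 3 * T := by ring
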